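/- **Setting.** A $\mathsf P$-labelled transition system $\mathbb S=(T,R,\kappa,s_I)$ consists of a set $T$, a relation $R\subseteq T^2$, a colouring $\kappa:T\to\wp(\mathsf P)$ and a node $s_I\in T$. Its $\omega$-unravelling $\mathbb S^\omega$ has as nodes the finite sequences $(s_1,k_1)\cdots(s_n,k_n)$ ($n\ge 0$, $k_i\in\omega$) such that $s_I,s_1,\dots,s_n$ is an $R$-path; its root is the empty sequence, the successors of a node are its one-step extensions, and the colour of a node is that of $s_n$ (of $s_I$ if $n=0$). For a finite set $A$ of monadic predicates let $\mathrm{FO}_1^+(A)$, $\mathrm{FOE}_1^+(A)$, $\mathrm{FOE}^{\infty+}_1(A)$ be the sets of sentences generated from $\top,\bot$, atoms $a(x)$ $(a\in A)$ and, for the last two, $x\approx y$ and $x\not\approx y$, by $\wedge,\vee,\exists,\forall$ and, for the last one, $\exists^\infty$ ("there are infinitely many") and $\forall^\infty$ ("all but finitely many"). They are interpreted in one-step models $(D,V)$, $V:A\to\wp(D)$, where $D=\varnothing$ is allowed; two sentences are equivalent, $\equiv$, if they hold in the same one-step models. The dual $\varphi^\delta$ is obtained by exchanging $\top/\bot$,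 $\wedge/\vee$, $\approx/\not\approx$, $\exists/\forall$, $\exists^\infty/\forall^\infty$. For $B\subseteq A$ the $B$-continuous fragment $\mathrm{Con}_B(L_1(A))$ is generated by $\varphi::=b(x)\mid\psi\mid\varphi\wedge\varphi\mid\varphi\vee\varphi\mid\exists x.\varphi$ with $b\in B$ and $\psi$ a positive formula of $L_1$ in which no $b\in B$ occurs, together with, for $L_1=\mathrm{FOE}_1^\infty$, the clause $\forall x(\varphi\vee\psi)\wedge\forall^\infty x\,\psi$; and $\varphi$ is in the $B$-cocontinuous fragment if $\varphi^\delta\in\mathrm{Con}_B(L_1(A))$. An $L_1$-automaton is $\mathbb A=(A,\Delta,\Omega,a_I)$ with $A$ finite, $a_I\in A$, $\Delta:A\times\wp(\mathsf P)\to L_1^+(A)$, $\Omega:A\to\mathbb N$. It accepts $\mathbb S$ if $\exists$ has a winning strategy from $(a_I,s_I)$ in the following game: at $(a,s)\in A\times T$ (priority $\Omega(a)$) player $\exists$ chooses $V:A\to\wp(R[s])$ with $(R[s],V)\models\Delta(a,\kappa(s))$; at $V$ (priority $0$) player $\forall$ chooses $(b,t)$ with $t\in V(b)$. A player who is stuck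 loses, and an infinite match is won by $\exists$ iff the largest priority occurring infinitely often is even. $\mathbb A\equiv\mathbb B$ means that $\mathbb A$ and $\mathbb B$ accept the same transition systems, and $\mathbb A$ is bisimulation invariant if, for bisimilar $\mathbb S,\mathbb S'$, it accepts $\mathbb S$ iff it accepts $\mathbb S'$. Let $\prec$ be the transitive closure of $\{(a,b)\mid b$ occurs in $\Delta(a,c)$ for some $c\}$; a cluster is a cell of the equivalence relation generated by $\prec\cap\succ$. $\mathbb A$ is weak ($\mathbb A\in\mathrm{Aut}_w(L_1)$) if $\Omega$ is constant on clusters, and weak-continuous ($\mathbb A\in\mathrm{Aut}_{wc}(L_1)$) if moreover, for every cluster $M$, $a\in M$ and $c$, $\Delta(a,c)$ is in the $M$-continuous fragment of $L_1(A)$ when $\Omega(a)$ is odd and in the $M$-cocontinuous fragment when $\Omega(a)$ is even. For $T\subseteq A$ put $\tau_T(x)=\bigwedge_{a\in T}a(x)$. The basic formulas are, for finite sequences $\vec T=(T_1,\dots,T_k)$ of subsets of $A$ and sets $\Pi,\Sigma\subseteq\{T_1,\dots,T_k\}$, $$\nabla_{\mathrm{FOE}}(\vec T,\Pi)=\exists\vec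 x\Big(\mathrm{diff}(\vec x)\wedge\bigwedge_i\tau_{T_i}(x_i)\wedge\forall z\big(\mathrm{diff}(\vec x,z)\to\bigvee_{S\in\Pi}\tau_S(z)\big)\Big),$$ $$\nabla_{\mathrm{FOE}^\infty}(\vec T,\Pi,\Sigma)=\nabla_{\mathrm{FOE}}(\vec T,\Pi\cup\Sigma)\wedge\bigwedge_{S\in\Sigma}\exists^\infty y\,\tau_S(y)\wedge\forall^\infty y\bigvee_{S\in\Sigma}\tau_S(y),$$ and a sentence is in basic $L_1$-form if it is a finite disjunction of basic formulas. Put $$\nabla_{\mathrm{FOE}}(\vec T,\Sigma)^\Diamond=\nabla_{\mathrm{FOE}^\infty}(\vec T,\Pi,\Sigma)^\Diamond=\bigwedge_i\exists x\,\tau_{T_i}(x)\wedge\forall x\bigvee_{S\in\Sigma}\tau_S(x),\qquad\Big(\bigvee_i\alpha_i\Big)^\Diamond=\bigvee_i\alpha_i^\Diamond .$$ A translation $(\cdot)^\Diamond:L_1^+(A)\to\mathrm{FO}_1^+(A)$ is obtained by choosing for every $\alpha\in L_1^+(A)$ an equivalent sentence $\alpha^\bullet$ in basic $L_1$-form and putting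 $\alpha^\Diamond:=(\alpha^\bullet)^\Diamond$; and $\mathbb A^\Diamond=(A,\Delta^\Diamond,\Omega,a_I)$ with $\Delta^\Diamond(a,c)=\Delta(a,c)^\Diamond$. **Theorem.** Let $L_1\in\{\mathrm{FOE}_1,\mathrm{FOE}_1^\infty\}$ and let $A$ be finite. There is a translation $(\cdot)^\Diamond$ as above such that every predicate occurring in $\alpha^\Diamond$ occurs in $\alpha$. Moreover, for every translation $(\cdot)^\Diamond$ as above and every $L_1$-automaton $\mathbb A$ with set of states $A$: 1. for every transition system $\mathbb S$, $\mathbb A^\Diamond$ accepts $\mathbb S$ iff $\mathbb A$ accepts $\mathbb S^\omega$; 2. $\mathbb A$ is bisimulation invariant iff $\mathbb A\equiv\mathbb A^\Diamond$; 3. if every predicate occurring in $\alpha^\Diamond$ occurs in $\alpha$, for all $\alpha\in L_1^+(A)$, then: if $\mathbb A\in\mathrm{Aut}_w(L_1)$ then $\mathbb A^\Diamond\in\mathrm{Aut}_w(\mathrm{FO}_1)$; and if $L_1=\mathrm{FOE}_1^\infty$ and $\mathbb A\in\mathrm{Aut}_{wc}(\mathrm{FOE}_1^\infty)$ then, up to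 replacing the sentences $\Delta^\Diamond(a,c)$ by equivalent sentences of $\mathrm{FO}_1^+(A)$, $\mathbb A^\Diamond\in\mathrm{Aut}_{wc}(\mathrm{FO}_1)$. -/

import Mathlib

universe u

namespace OneStepAut

/-! ### Labelled transition systems, bisimulations and the omega-unravelling -/

/-- A transition system labelled over the set `P` of proposition letters, with a distinguished
node. -/
structure LTS (P : Type*) where
  Node : Type u
  R : Node → Node → Prop
  color : Node → Set P
  root : Node

/-- `Z` is a bisimulation between `S` and `S'`. -/
def IsBisimulation {P : Type*} (S S' : LTS.{u} P) (Z : S.Node → S'.Node → Prop) : Prop :=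
  ∀ t t', Z t t' →
    S.color t = S'.color t' ∧
    (∀ s, S.R t s → ∃ s', S'.R t' s' ∧ Z s s') ∧
    (∀ s', S'.R t' s' → ∃ s, S.R t s ∧ Z s s')

/-- The distinguished nodes are linked by a bisimulation. -/
def Bisimilar {P : Type*} (S S' : LTS.{u} P) : Prop :=
  ∃ Z : S.Node → S'.Node → Prop, IsBisimulation S S' Z ∧ Z S.root S'.root

/-- The omega-unravelling: the nodes are the finite paths `root, (s₁, k₁), …, (sₙ, kₙ)` of `S` in
which every node other than the root carries the index of one of its `ω`-many copies; the root
itself is represented by the empty list. -/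
def LTS.omegaUnravel {P : Type*} (S : LTS.{u} P) : LTS.{u} P where
  Node := {l : List (S.Node × ℕ) // List.IsChain S.R (S.root :: l.map Prod.fst)}
  R := fun l l' => ∃ p : S.Node × ℕ, l'.1 = l.1 ++ [p]
  color := fun l => S.color ((l.1.map Prod.fst).getLastD S.root)
  root := ⟨[], by simp⟩

/-! ### Board games and winning strategies -/

/-- A board game with board `G`: positions in `eloise` belong to Eloise, all the others to
Abelard. -/
structure BoardGame (G : Type*) where
  eloise : G → Prop
  move : G → G → Prop
  win : (ℕ → G) → Prop

/-- The parity winning condition: the maximal priority that is met infinitely often is even. -/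
def ParityWin {G : Type*} (prio : G → ℕ) (π : ℕ → G) : Prop :=
  ∃ n, Even n ∧ (∃ᶠ i in Filter.atTop, prio (π i) = n) ∧
    ∀ m, (∃ᶠ i in Filter.atTop, prio (π i) = m) → m ≤ n

/-- `f` is a winning strategy for Eloise in the game initialized at `u`. The first clause says that
in every finite `f`-guided match ending in a position of Eloise the move chosen by `f` is
admissible (so that Eloise never gets stuck), the second one that Eloise wins every infinite
`f`-guided match. A finite match in which Abelard is stuck is won by Eloise. -/
def BoardGame.EloiseWinsWith {G : Type*} (𝒢 : BoardGame G) (u : G) (f : List G → G) : Prop :=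
  (∀ l : List G, ∀ last : G, l.head? = some u → l.getLast? = some last →
    List.IsChain 𝒢.move l →
    (∀ i, ∀ h : i + 1 < l.length, 𝒢.eloise l[i] → l[i + 1] = f (l.take (i + 1))) →
    𝒢.eloise last → 𝒢.move last (f l)) ∧
  (∀ π : ℕ → G, π 0 = u →
    (∀ i, 𝒢.move (π i) (π (i + 1))) →
    (∀ i, 𝒢.eloise (π i) → π (i + 1) = f ((List.range (i + 1)).map π)) →
    𝒢.win π)

/-- `u` is a winning position for Eloise. -/
def BoardGame.EloiseWins {G : Type*} (𝒢 : BoardGame G) (u : G) : Prop :=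
  ∃ f : List G → G, 𝒢.EloiseWinsWith u f

/-! ### One-step languages -/

/-- The one-step languages: monadic first-order logic without equality, with equality, and with
equality and the infinity quantifiers. -/
inductive Lang
  | FO
  | FOE
  | FOEI

/-- Positive monadic formulas over the predicates `A` with free individual variables among
`0, …, n - 1`; a quantifier binds the last variable. Sentences are the elements of
`Formula A 0`. -/
inductive Formula (A : Type*) : ℕ → Type _
  | pred {n : ℕ} (a : A) (x : Fin n) : Formula A n
  | eq {n : ℕ} (x y : Fin n) : Formula A n
  | neq {n : ℕ} (x y : Fin n) : Formula A n
  | top {n : ℕ} : Formula A n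
  | bot {n : ℕ} : Formula A n
  | and {n : ℕ} (φ ψ : Formula A n) : Formula A n
  | or {n : ℕ} (φ ψ : Formula A n) : Formula A n
  | ex {n : ℕ} (φ : Formula A (n + 1)) : Formula A n
  | all {n : ℕ} (φ : Formula A (n + 1)) : Formula A n
  | exInf {n : ℕ} (φ : Formula A (n + 1)) : Formula A n
  | allInf {n : ℕ} (φ : Formula A (n + 1)) : Formula A n

namespace Formula

variable {A : Type*}

/-- Membership of a formula in the positive fragment of a one-step language. -/
def In (L : Lang) : {n : ℕ} → Formula A n → Prop
  | _, pred _ _ => True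
  | _, eq _ _ => L ≠ Lang.FO
  | _, neq _ _ => L ≠ Lang.FO
  | _, top => True
  | _, bot => True
  | _, and φ ψ => φ.In L ∧ ψ.In L
  | _, or φ ψ => φ.In L ∧ ψ.In L
  | _, ex φ => φ.In L
  | _, all φ => φ.In L
  | _, exInf φ => L = Lang.FOEI ∧ φ.In L
  | _, allInf φ => L = Lang.FOEI ∧ φ.In L

/-- The predicate `a` occurs in the formula. -/
def Occurs (a : A) : {n : ℕ} → Formula A n → Prop
  | _, pred b _ => b = a
  | _, eq _ _ => False
  | _, neq _ _ => False
  | _, top => False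
  | _, bot => False
  | _, and φ ψ => φ.Occurs a ∨ ψ.Occurs a
  | _, or φ ψ => φ.Occurs a ∨ ψ.Occurs a
  | _, ex φ => φ.Occurs a
  | _, all φ => φ.Occurs a
  | _, exInf φ => φ.Occurs a
  | _, allInf φ => φ.Occurs a

/-- Truth in the one-step model `(D, V)` under the assignment `g`. The domain may be empty. -/
def Sat {D : Type*} (V : A → Set D) : {n : ℕ} → Formula A n → (Fin n → D) → Prop
  | _, pred a x, g => g x ∈ V a
  | _, eq x y, g => g x = g y
  | _, neq x y, g => g x ≠ g y
  | _, top, _ => True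
  | _, bot, _ => False
  | _, and φ ψ, g => φ.Sat V g ∧ ψ.Sat V g
  | _, or φ ψ, g => φ.Sat V g ∨ ψ.Sat V g
  | _, ex φ, g => ∃ d : D, φ.Sat V (Fin.snoc g d)
  | _, all φ, g => ∀ d : D, φ.Sat V (Fin.snoc g d)
  | _, exInf φ, g => {d : D | φ.Sat V (Fin.snoc g d)}.Infinite
  | _, allInf φ, g => {d : D | ¬ φ.Sat V (Fin.snoc g d)}.Finite

/-- Truth of a sentence in a one-step model. -/
def Holds {D : Type*} (V : A → Set D) (φ : Formula A 0) : Prop :=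
  φ.Sat V Fin.elim0

/-- Equivalence of one-step sentences: they hold in the same one-step models. -/
def Equiv (φ ψ : Formula A 0) : Prop :=
  ∀ (D : Type u) (V : A → Set D), φ.Holds V ↔ ψ.Holds V

/-- The boolean dual. -/
def dual : {n : ℕ} → Formula A n → Formula A n
  | _, pred a x => pred a x
  | _, eq x y => neq x y
  | _, neq x y => eq x y
  | _, top => bot
  | _, bot => top
  | _, and φ ψ => or φ.dual ψ.dual
  | _, or φ ψ => and φ.dual ψ.dual
  | _, ex φ => all φ.dual
  | _, all φ => ex φ.dual
  | _, exInf φ => allInf φ.dual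
  | _, allInf φ => exInf φ.dual

/-- The `B`-continuous fragment of the one-step language `L`, for `B ⊆ A`. The last clause, which
is available only in the language with infinity quantifiers, is the formula
`∀ x (φ ∨ ψ) ∧ ∀^∞ x ψ`. -/
inductive Cont (L : Lang) (B : Set A) : {n : ℕ} → Formula A n → Prop
  | pred {n : ℕ} (b : A) (x : Fin n) : b ∈ B → Cont L B (Formula.pred b x)
  | free {n : ℕ} (ψ : Formula A n) : ψ.In L → (∀ b ∈ B, ¬ ψ.Occurs b) → Cont L B ψ
  | and {n : ℕ} (φ ψ : Formula A n) : Cont L B φ → Cont L B ψ → Cont L B (Formula.and φ ψ)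
  | or {n : ℕ} (φ ψ : Formula A n) : Cont L B φ → Cont L B ψ → Cont L B (Formula.or φ ψ)
  | ex {n : ℕ} (φ : Formula A (n + 1)) : Cont L B φ → Cont L B (Formula.ex φ)
  | weakAll {n : ℕ} (φ ψ : Formula A (n + 1)) : L = Lang.FOEI → Cont L B φ → ψ.In L →
      (∀ b ∈ B, ¬ ψ.Occurs b) →
      Cont L B (Formula.and (Formula.all (Formula.or φ ψ)) (Formula.allInf ψ))

/-- The `B`-cocontinuous fragment. -/
def Cocont (L : Lang) (B : Set A) {n : ℕ} (φ : Formula A n) : Prop :=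
  φ.dual.Cont L B

/-- Finite conjunctions; the empty one is `⊤`. -/
def bigAnd {n : ℕ} (l : List (Formula A n)) : Formula A n := l.foldr and top

/-- Finite disjunctions; the empty one is `⊥`. -/
def bigOr {n : ℕ} (l : List (Formula A n)) : Formula A n := l.foldr or bot

/-- Existential closure. -/
def exs : (n : ℕ) → Formula A n → Formula A 0
  | 0, φ => φ
  | n + 1, φ => exs n (ex φ)

/-- `x₀, …, xₙ₋₁` are pairwise distinct. -/
def diff (n : ℕ) : Formula A n :=
  bigAnd (((List.finRange n ×ˢ List.finRange n).filter fun p => p.1 < p.2).map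
    fun p => neq p.1 p.2)

/-- A type is a (finite) set `T` of predicates; this is the formula `⋀_{a ∈ T} a(x)`. -/
noncomputable def typeFormula {n : ℕ} (T : Finset A) (x : Fin n) : Formula A n :=
  bigAnd (T.toList.map fun a => pred a x)

/-- The disjunction of `⋀_{a ∈ S} a(x)` over the types `S` in the list. -/
noncomputable def someType {n : ℕ} (Ss : List (Finset A)) (x : Fin n) : Formula A n :=
  bigOr (Ss.map fun S => typeFormula S x)

/-- The basic formula with equality: there are distinct elements of types `T₁, …, T_k`, and all
the other elements have a type in `Ps`. The implication `diff(x, z) → …` is written as a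
disjunction; the dual of `diff` is its negation as no predicate occurs in it. -/
noncomputable def nablaFOE (Ts Ps : List (Finset A)) : Formula A 0 :=
  exs Ts.length
    (and (diff Ts.length)
      (and (bigAnd ((List.finRange Ts.length).map fun i => typeFormula (Ts.get i) i))
        (all (or (diff (Ts.length + 1)).dual (someType Ps (Fin.last Ts.length))))))

/-- Every type in `Ss` is witnessed infinitely often, and all but finitely many elements have a
type in `Ss`. -/
noncomputable def nablaInf (Ss : List (Finset A)) : Formula A 0 :=
  and (bigAnd (Ss.map fun S => exInf (typeFormula S (Fin.last 0))))
    (allInf (someType Ss (Fin.last 0)))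

/-- The basic formula of the language with infinity quantifiers. -/
noncomputable def nablaFOEI (Ts Ps Ss : List (Finset A)) : Formula A 0 :=
  and (nablaFOE Ts (Ps ++ Ss)) (nablaInf Ss)

/-- `⋀ᵢ ∃ x T_i(x) ∧ ∀ x ⋁_{S} S(x)`. -/
noncomputable def nablaFO (Ts Ss : List (Finset A)) : Formula A 0 :=
  and (bigAnd (Ts.map fun T => ex (typeFormula T (Fin.last 0))))
    (all (someType Ss (Fin.last 0)))

/-- `BasicDiamond L α β`: the sentence `α` is a disjunct of a basic form of `L`, and `β` is its
translation into the language without equality. -/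
inductive BasicDiamond : Lang → Formula A 0 → Formula A 0 → Prop
  | foe (Ts Ps : List (Finset A)) : (∀ S ∈ Ps, S ∈ Ts) →
      BasicDiamond Lang.FOE (nablaFOE Ts Ps) (nablaFO Ts Ps)
  | foei (Ts Ps Ss : List (Finset A)) : (∀ S ∈ Ps ++ Ss, S ∈ Ts) →
      BasicDiamond Lang.FOEI (nablaFOEI Ts Ps Ss) (nablaFO Ts Ss)

/-- `β` is obtained from some basic form of `α`, that is, from a disjunction of basic formulas
that is equivalent to `α`, by translating every disjunct. -/
def IsDiamond (L : Lang) (α β : Formula A 0) : Prop :=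
  ∃ l : List (Formula A 0 × Formula A 0),
    (∀ p ∈ l, BasicDiamond L p.1 p.2) ∧
    Equiv.{u} α (bigOr (l.map Prod.fst)) ∧
    β = bigOr (l.map Prod.snd)

/-- `d` is a translation `(·)^◇` of the positive sentences of `L` into positive sentences without
equality, defined on the basis of a choice of a basic form for every sentence. -/
def IsDiamondTranslation (L : Lang) (d : Formula A 0 → Formula A 0) : Prop :=
  ∀ α : Formula A 0, α.In L → IsDiamond.{u} L α (d α)

/-- The translation introduces no predicates that do not occur in the given sentence. -/
def AddsNoPredicate (L : Lang) (d : Formula A 0 → Formula A 0) : Prop :=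
  ∀ α : Formula A 0, α.In L → ∀ a : A, (d α).Occurs a → α.Occurs a

theorem bigAnd_in {L : Lang} {n : ℕ} {l : List (Formula A n)} (h : ∀ φ ∈ l, φ.In L) :
    (bigAnd l).In L := by
  induction l with
  | nil => simp [bigAnd, In]
  | cons φ l ih =>
    exact ⟨h φ (by simp), ih fun ψ hψ => h ψ (by simp [hψ])⟩

theorem bigOr_in {L : Lang} {n : ℕ} {l : List (Formula A n)} (h : ∀ φ ∈ l, φ.In L) :
    (bigOr l).In L := by
  induction l with
  | nil => simp [bigOr, In]
  | cons φ l ih =>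
    exact ⟨h φ (by simp), ih fun ψ hψ => h ψ (by simp [hψ])⟩

theorem typeFormula_in {L : Lang} {n : ℕ} (T : Finset A) (x : Fin n) :
    (typeFormula T x).In L := by
  apply bigAnd_in
  intro φ hφ
  obtain ⟨a, -, rfl⟩ := List.mem_map.1 hφ
  simp [In]

theorem nablaFO_in (Ts Ss : List (Finset A)) : (nablaFO Ts Ss).In Lang.FO := by
  refine ⟨bigAnd_in ?_, bigOr_in ?_⟩
  · intro φ hφ
    obtain ⟨T, -, rfl⟩ := List.mem_map.1 hφ
    exact typeFormula_in T _
  · intro φ hφ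
    obtain ⟨T, -, rfl⟩ := List.mem_map.1 hφ
    exact typeFormula_in T _

theorem IsDiamond.in_FO {L : Lang} {α β : Formula A 0} (h : IsDiamond.{u} L α β) :
    β.In Lang.FO := by
  obtain ⟨l, hl, -, rfl⟩ := h
  apply bigOr_in
  intro φ hφ
  obtain ⟨p, hp, rfl⟩ := List.mem_map.1 hφ
  have h2 := hl p hp
  generalize p.1 = γ at h2
  generalize p.2 = δ at h2
  cases h2 <;> exact nablaFO_in _ _

end Formula

/-! ### Parity automata -/

/-- Parity automata based on the one-step language `L`, with set of states `A` (taken to be finite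
below) and proposition letters `P`. -/
structure Automaton (L : Lang) (A P : Type*) where
  delta : A → Set P → Formula A 0
  delta_in : ∀ a c, (delta a c).In L
  prio : A → ℕ
  init : A

namespace Automaton

variable {L L' : Lang} {A P : Type*}

/-- The acceptance game. At a basic position `(a, s)` Eloise picks a valuation `V : A → ℘(R[s])`
that makes `delta a (color s)` true in the one-step model with domain `R[s]`; at a position `V`
Abelard picks a pair `(b, t)` with `t ∈ V b`. -/
def acceptanceGame (𝔸 : Automaton L A P) (S : LTS.{u} P) :
    BoardGame ((A × S.Node) ⊕ (A → Set S.Node)) where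
  eloise := fun p => p.isLeft
  move := fun p q =>
    match p, q with
    | Sum.inl (a, s), Sum.inr V =>
        (∀ b, V b ⊆ {t | S.R s t}) ∧
        (𝔸.delta a (S.color s)).Holds (fun b => {t : {t : S.Node // S.R s t} | t.1 ∈ V b})
    | Sum.inr V, Sum.inl (b, t) => t ∈ V b
    | _, _ => False
  win := ParityWin (Sum.elim (fun p => 𝔸.prio p.1) (fun _ => 0))

/-- Acceptance of a transition system. -/
def Accepts (𝔸 : Automaton L A P) (S : LTS.{u} P) : Prop :=
  (𝔸.acceptanceGame S).EloiseWins (Sum.inl (𝔸.init, S.root))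

/-- Acceptance is invariant under bisimilarity. -/
def BisimulationInvariant (𝔸 : Automaton L A P) : Prop :=
  ∀ S S' : LTS.{u} P, Bisimilar S S' → (𝔸.Accepts S ↔ 𝔸.Accepts S')

/-- The two automata accept the same transition systems. -/
def Equivalent (𝔸 : Automaton L A P) (𝔹 : Automaton L' A P) : Prop :=
  ∀ S : LTS.{u} P, 𝔸.Accepts S ↔ 𝔹.Accepts S

/-- `b` is active in `a`. -/
def Active (𝔸 : Automaton L A P) : A → A → Prop :=
  Relation.TransGen fun a b => ∃ c, (𝔸.delta a c).Occurs b

/-- `a` and `b` belong to the same cluster. -/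
def SameCluster (𝔸 : Automaton L A P) : A → A → Prop :=
  Relation.EqvGen fun a b => 𝔸.Active a b ∧ 𝔸.Active b a

/-- Weakness. -/
def Weak (𝔸 : Automaton L A P) : Prop :=
  ∀ a b, 𝔸.SameCluster a b → 𝔸.prio a = 𝔸.prio b

/-- Continuity: transition formulas are continuous (at odd states) or cocontinuous (at even
states) in the cluster of the state. -/
def Continuity (𝔸 : Automaton L A P) : Prop :=
  ∀ a c,
    (Odd (𝔸.prio a) → (𝔸.delta a c).Cont L {b | 𝔸.SameCluster a b}) ∧
    (Even (𝔸.prio a) → (𝔸.delta a c).Cocont L {b | 𝔸.SameCluster a b})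

/-- Weak-continuous automata. -/
def WeakContinuous (𝔸 : Automaton L A P) : Prop :=
  𝔸.Weak ∧ 𝔸.Continuity

/-- The two automata differ only in that transition formulas are replaced by equivalent
one-step formulas. -/
def OneStepEquiv (𝔸 : Automaton L A P) (𝔹 : Automaton L' A P) : Prop :=
  𝔸.init = 𝔹.init ∧ 𝔸.prio = 𝔹.prio ∧
    ∀ a c, Formula.Equiv.{u} (𝔸.delta a c) (𝔹.delta a c)

/-- The automaton `𝔸^◇` over the language without equality. -/
def diamond (𝔸 : Automaton L A P) (d : Formula A 0 → Formula A 0)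
    (hd : Formula.IsDiamondTranslation.{u} L d) : Automaton Lang.FO A P where
  delta := fun a c => d (𝔸.delta a c)
  delta_in := fun a c => (hd _ (𝔸.delta_in a c)).in_FO
  prio := 𝔸.prio
  init := 𝔸.init

end Automaton

end OneStepAut

open OneStepAut

/-!
The proof separates a one-step part, about single sentences, from a transfer of strategies between
acceptance games.

Along a map `p : E → D` all of whose fibres are infinite, a basic formula holds in the inverse image
of `(D, V)` iff its translation holds in `(D, V)`: every type realized in `D` is realized infinitely
often in `E`, so distinct witnesses are always available, while neither finitely many witnesses nor
finitely many exceptions can exhaust a fibre (`Formula.IsDiamond.holds_iff`). As the successors of a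
node of the omega-unravelling are mapped in this way onto those of the underlying node, a winning
strategy in either acceptance game can be imitated in the other one, by taking inverse images or, as
positive sentences are monotone, images of valuations (`Automaton.Accepts.of_relation`, which rests
on `BoardGame.EloiseWins.of_simulation`). Together with the bisimilarity of a system and its
omega-unravelling and the bisimulation invariance of automata without equality this gives the first
two claims.

That basic forms exist, without new predicates, is a back-and-forth argument: the truth of a
sentence depends only on how many elements realize each type, up to a threshold exceeding the
quantifier depth (and on whether they are infinitely many) (`Formula.SameProfile.sat_iff`). A
sentence is equivalent to the disjunction of the basic formulas that describe its models: in a model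
of such a formula the valuation can be shrunk to one with the described numbers
(`Formula.IsProfile.exists_sameProfile`), and monotonicity takes care of the difference. Keeping
infinitely many elements for each of several types when shrinking requires distinct representatives,
supplied by Hall's theorem.

Weakness passes to the translation because no new predicates, hence no larger clusters, arise. For
continuity in `B`, a continuous sentence remains true over `D × ω` if the predicates in `B` are
restricted to a finite set; every fibre then contains elements in no `b ∈ B`, so that only the types
disjoint from `B` matter in the universal part of the translation, and dropping the other ones
yields a continuous equivalent (`Formula.IsDiamond.exists_cont`). The cocontinuous case follows by
duality, the translation of the dual sentence being equivalent to the dual of the translation.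
-/

namespace OneStepAut

/-! ### Board games: transfer of winning strategies along simulations -/

/-- A winning strategy, with the finite matches presented as initial segments of sequences. -/
theorem BoardGame.eloiseWinsWith_iff {G : Type*} (𝒢 : BoardGame G) (u : G) (f : List G → G) :
    𝒢.EloiseWinsWith u f ↔
      (∀ (π : ℕ → G) (n : ℕ), π 0 = u → (∀ i < n, 𝒢.move (π i) (π (i + 1))) →
        (∀ i < n, 𝒢.eloise (π i) → π (i + 1) = f ((List.range (i + 1)).map π)) →
        𝒢.eloise (π n) → 𝒢.move (π n) (f ((List.range (n + 1)).map π))) ∧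
      (∀ π : ℕ → G, π 0 = u → (∀ i, 𝒢.move (π i) (π (i + 1))) →
        (∀ i, 𝒢.eloise (π i) → π (i + 1) = f ((List.range (i + 1)).map π)) → 𝒢.win π) := by
  refine and_congr_left fun _ => ⟨fun h π n h0 hm hf he => ?_, fun h l last hh hl hc hf he => ?_⟩
  · refine h _ (π n) (by simp [List.range_succ_eq_map, h0]) (by simp [List.range_succ]) ?_ ?_ he
    · rw [List.isChain_iff_getElem]
      intro i hi
      simp only [List.length_map, List.length_range] at hi
      simpa using hm i (by omega)
    · intro i hi hei
      simp only [List.length_map, List.length_range] at hi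
      simp only [List.getElem_map, List.getElem_range] at hei ⊢
      rw [hf i (by omega) hei, ← List.map_take, List.take_range, min_eq_left (by omega)]
  · have hne : l ≠ [] := by rintro rfl; simp at hh
    obtain ⟨n, hn⟩ : ∃ n, l.length = n + 1 :=
      Nat.exists_eq_succ_of_ne_zero (by simpa using hne)
    have hget : ∀ i, ∀ hi : i < l.length, l.getD i u = l[i] := fun i hi => by simp [hi]
    have htake : ∀ i, i ≤ l.length → (List.range i).map (fun j => l.getD j u) = l.take i := by
      intro i hi
      apply List.ext_getElem
      · simp [hi]
      · intro j h1 h2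
        simp only [List.length_map, List.length_range] at h1
        have hj : j < l.length := by omega
        simp [hj]
    have hlast : l.getD n u = last := by
      rw [List.getLast?_eq_getElem?, hn] at hl
      simp only [Nat.add_sub_cancel] at hl
      simp [List.getD, hl]
    have := h (fun i => l.getD i u) n ?_ ?_ ?_ ?_
    · rw [htake (n + 1) (by omega), ← hn, List.take_length] at this
      simpa only [hlast] using this
    · rw [List.head?_eq_getElem?] at hh
      simp [List.getD, hh]
    · intro i hi
      rw [hget i (by omega), hget (i + 1) (by omega)]
      exact List.isChain_iff_getElem.1 hc i (by omega)
    · intro i hi hei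
      rw [hget i (by omega)] at hei
      rw [hget (i + 1) (by omega), htake (i + 1) (by omega)]
      exact hf i (by omega) hei
    · simpa only [hlast] using he

/-- The position of `𝒢` by which the shadow match `h` is continued when the match of the other game
proceeds to `v'`: the one dictated by the strategy `f` at positions of Eloise, and one that Abelard
can move to and that is related to `v'` otherwise. The start `u` stands in for the last position if
`h` is empty. -/
noncomputable def BoardGame.shadowMove {G G' : Type*} (𝒢 : BoardGame G) (Z : G → G' → Prop)
    (f : List G → G) (u : G) (h : List G) (v' : G') : G :=
  open Classical in
  if 𝒢.eloise (h.getLastD u) then f h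
  else @Classical.epsilon G ⟨u⟩ fun v => 𝒢.move (h.getLastD u) v ∧ Z v v'

/-- The match of `𝒢`, starting in `u` and guided by `f`, that shadows the given finite match of
another game. -/
noncomputable def BoardGame.shadow {G G' : Type*} (𝒢 : BoardGame G) (Z : G → G' → Prop)
    (f : List G → G) (u : G) (l : List G') : List G :=
  l.tail.foldl (fun h v' => h ++ [𝒢.shadowMove Z f u h v']) [u]

theorem BoardGame.shadow_range_succ {G G' : Type*} (𝒢 : BoardGame G) (Z : G → G' → Prop)
    (f : List G → G) (u : G) (π : ℕ → G') (n : ℕ) :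
    𝒢.shadow Z f u ((List.range (n + 2)).map π) =
      𝒢.shadow Z f u ((List.range (n + 1)).map π) ++
        [𝒢.shadowMove Z f u (𝒢.shadow Z f u ((List.range (n + 1)).map π)) (π (n + 1))] := by
  unfold shadow
  rw [List.range_succ (n := n + 1), List.map_append, List.tail_append_of_ne_nil (by simp),
    List.foldl_append]
  simp

/-- Winning positions are transferred along a relation `Z` that lets every move of Eloise be
imitated in the second game and every move of Abelard in the second game be imitated in the first
one, and that respects the winning condition. The strategies are arbitrary, hence the whole
history of a match has to be carried along. -/
theorem BoardGame.EloiseWins.of_simulation {G G' : Type*} {𝒢 : BoardGame G} {𝒢' : BoardGame G'}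
    (Z : G → G' → Prop) (he : ∀ u u', Z u u' → (𝒢.eloise u ↔ 𝒢'.eloise u'))
    (hE : ∀ u u' v, Z u u' → 𝒢.eloise u → 𝒢.move u v → ∃ v', 𝒢'.move u' v' ∧ Z v v')
    (hA : ∀ u u' v', Z u u' → ¬ 𝒢.eloise u → 𝒢'.move u' v' → ∃ v, 𝒢.move u v ∧ Z v v')
    (hw : ∀ π π', (∀ i, Z (π i) (π' i)) → 𝒢.win π → 𝒢'.win π')
    {u : G} {u' : G'} (hu : Z u u') (h : 𝒢.EloiseWins u) : 𝒢'.EloiseWins u' := by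
  obtain ⟨f, hf⟩ := h
  rw [BoardGame.eloiseWinsWith_iff] at hf
  obtain ⟨hf1, hf2⟩ := hf
  let sh := 𝒢.shadow Z f u
  let f' : List G' → G' := fun l' => @Classical.epsilon G' ⟨u'⟩ fun v' =>
    𝒢'.move (l'.getLastD u') v' ∧ Z (f (sh l')) v'
  let shadowSeq : (ℕ → G') → ℕ → G := fun π' i => (sh ((List.range (i + 1)).map π')).getLastD u
  have hsh : ∀ (π' : ℕ → G') i,
      sh ((List.range (i + 1)).map π') = (List.range (i + 1)).map (shadowSeq π') := by
    intro π' i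
    induction i with
    | zero => simp [shadowSeq, sh, shadow]
    | succ i ih =>
      rw [show sh _ = _ from 𝒢.shadow_range_succ Z f u π' i, List.range_succ (n := i + 1),
        List.map_append, ← ih]
      simp only [List.map_cons, List.map_nil, shadowSeq]
      rw [show sh _ = _ from 𝒢.shadow_range_succ Z f u π' i]
      simp [sh]
  have hsucc : ∀ (π' : ℕ → G') i, shadowSeq π' (i + 1) =
      𝒢.shadowMove Z f u ((List.range (i + 1)).map (shadowSeq π')) (π' (i + 1)) := by
    intro π' i
    rw [← hsh]
    simp only [shadowSeq]
    rw [show sh _ = _ from 𝒢.shadow_range_succ Z f u π' i]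
    simp [sh]
  have hzero : ∀ π', shadowSeq π' 0 = u := fun π' => by simp [shadowSeq, sh, shadow]
  have hguided : ∀ π' i, 𝒢.eloise (shadowSeq π' i) →
      shadowSeq π' (i + 1) = f ((List.range (i + 1)).map (shadowSeq π')) := by
    intro π' i hi
    rw [hsucc, shadowMove, if_pos]
    simpa [List.range_succ] using hi
  have hlast' : ∀ (π' : ℕ → G') i, ((List.range (i + 1)).map π').getLastD u' = π' i := by
    intro π' i; simp [List.range_succ]
  have hlast : ∀ (π : ℕ → G) i, ((List.range (i + 1)).map π).getLastD u = π i := by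
    intro π' i; simp [List.range_succ]
  -- As long as the second match is guided by `f'`, its shadow is a match related to it by `Z`.
  have key : ∀ (π' : ℕ → G') n, π' 0 = u' → (∀ i < n, 𝒢'.move (π' i) (π' (i + 1))) →
      (∀ i < n, 𝒢'.eloise (π' i) → π' (i + 1) = f' ((List.range (i + 1)).map π')) →
      Z (shadowSeq π' n) (π' n) ∧ (∀ i < n, 𝒢.move (shadowSeq π' i) (shadowSeq π' (i + 1))) ∧
      (𝒢'.eloise (π' n) → 𝒢'.move (π' n) (f' ((List.range (n + 1)).map π')) ∧
        Z (f ((List.range (n + 1)).map (shadowSeq π'))) (f' ((List.range (n + 1)).map π'))) := by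
    intro π' n h0 hm hg
    have step : ∀ n, Z (shadowSeq π' n) (π' n) →
        (∀ i < n, 𝒢.move (shadowSeq π' i) (shadowSeq π' (i + 1))) →
        (𝒢'.eloise (π' n) →
          𝒢.move (shadowSeq π' n) (f ((List.range (n + 1)).map (shadowSeq π'))) ∧
          𝒢'.move (π' n) (f' ((List.range (n + 1)).map π')) ∧
          Z (f ((List.range (n + 1)).map (shadowSeq π')))
            (f' ((List.range (n + 1)).map π'))) := by
      intro n hZ hmv hel
      have hel' := (he _ _ hZ).2 hel
      have hmove := hf1 (shadowSeq π') n (hzero π') hmv (fun i _ => hguided π' i) hel'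
      refine ⟨hmove, ?_⟩
      obtain ⟨v', hv'⟩ := hE _ _ _ hZ hel' hmove
      have := @Classical.epsilon_spec_aux G' ⟨u'⟩ (fun v' => 𝒢'.move (π' n) v' ∧
        Z (f ((List.range (n + 1)).map (shadowSeq π'))) v') ⟨v', hv'⟩
      simp only [f', hlast', hsh]
      exact this
    induction n with
    | zero =>
      have hZ : Z (shadowSeq π' 0) (π' 0) := by rw [hzero, h0]; exact hu
      exact ⟨hZ, by simp, fun hel => (step 0 hZ (by simp) hel).2⟩
    | succ n ih =>
      obtain ⟨hZ, hmv, hel⟩ := ih (fun i hi => hm i (by omega)) (fun i hi => hg i (by omega))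
      have hnew : 𝒢.move (shadowSeq π' n) (shadowSeq π' (n + 1)) ∧
          Z (shadowSeq π' (n + 1)) (π' (n + 1)) := by
        by_cases hen : 𝒢'.eloise (π' n)
        · obtain ⟨h1, h2, h3⟩ := step n hZ hmv hen
          rw [hguided π' n ((he _ _ hZ).2 hen), hg n (by omega) hen]
          exact ⟨h1, h3⟩
        · have hen' : ¬ 𝒢.eloise (shadowSeq π' n) := fun hh => hen ((he _ _ hZ).1 hh)
          rw [hsucc, shadowMove, hlast, if_neg hen']
          exact @Classical.epsilon_spec_aux G ⟨u⟩
            (fun v => 𝒢.move (shadowSeq π' n) v ∧ Z v (π' (n + 1)))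
            (hA _ _ _ hZ hen' (hm n (by omega)))
      have hmv' : ∀ i < n + 1, 𝒢.move (shadowSeq π' i) (shadowSeq π' (i + 1)) := by
        intro i hi
        rcases Nat.lt_succ_iff_lt_or_eq.1 hi with hi | rfl
        · exact hmv i hi
        · exact hnew.1
      exact ⟨hnew.2, hmv', fun hel => (step (n + 1) hnew.2 hmv' hel).2⟩
  refine ⟨f', (BoardGame.eloiseWinsWith_iff _ _ _).2 ⟨?_, ?_⟩⟩
  · intro π' n h0 hm hg hel
    exact ((key π' n h0 hm hg).2.2 hel).1
  · intro π' h0 hm hg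
    have hk := fun n => key π' n h0 (fun i _ => hm i) (fun i _ => hg i)
    exact hw (shadowSeq π') π' (fun n => (hk n).1)
      (hf2 _ (hzero π') (fun i => (hk (i + 1)).2.1 i (by omega)) (hguided π'))

/-- Acceptance is transferred along a relation `Z` between the nodes of two transition systems
such that, whenever a valuation of the successors of `s` makes the transition formula of the first
automaton true, its image under `Z` makes that of the second automaton true. -/
theorem Automaton.Accepts.of_relation {L L' : Lang} {A P : Type*} {𝔸 : Automaton L A P}
    {𝔹 : Automaton L' A P} {S S' : LTS.{u} P} (Z : S.Node → S'.Node → Prop)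
    (hinit : 𝔸.init = 𝔹.init) (hprio : 𝔸.prio = 𝔹.prio) (hroot : Z S.root S'.root)
    (hstep : ∀ a s s', Z s s' → ∀ V : A → Set {t : S.Node // S.R s t},
      (𝔸.delta a (S.color s)).Holds V →
      (𝔹.delta a (S'.color s')).Holds
        (fun b => {t' : {t' : S'.Node // S'.R s' t'} | ∃ t ∈ V b, Z t.1 t'.1}))
    (h : 𝔸.Accepts S) : 𝔹.Accepts S' := by
  let W : ((A × S.Node) ⊕ (A → Set S.Node)) → ((A × S'.Node) ⊕ (A → Set S'.Node)) → Prop :=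
    fun p q => match p, q with
      | Sum.inl (a, s), Sum.inl (a', s') => a = a' ∧ Z s s'
      | Sum.inr V, Sum.inr V' => ∀ b, ∀ t' ∈ V' b, ∃ t ∈ V b, Z t t'
      | _, _ => False
  refine BoardGame.EloiseWins.of_simulation W ?_ ?_ ?_ ?_
    (show W (Sum.inl (𝔸.init, S.root)) (Sum.inl (𝔹.init, S'.root)) from ⟨hinit, hroot⟩) h
  · rintro (⟨a, s⟩ | V) (⟨a', s'⟩ | V') hW <;> simp_all [W, acceptanceGame]
  · rintro (⟨a, s⟩ | V) (⟨a', s'⟩ | V') (⟨b, t⟩ | U) hW hel hm <;>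
      simp only [W, acceptanceGame] at hW hel hm
    · obtain ⟨rfl, hZ⟩ := hW
      obtain ⟨hU, hm⟩ := hm
      refine ⟨Sum.inr fun b => {t' | S'.R s' t' ∧ ∃ t ∈ U b, Z t t'}, ⟨?_, ?_⟩, ?_⟩
      · exact fun b t' ht' => ht'.1
      · have h2 := hstep a s s' hZ _ hm
        convert h2 using 2 with b
        ext t'
        constructor
        · rintro ⟨-, t, ht, hz⟩
          exact ⟨⟨t, hU b ht⟩, ht, hz⟩
        · rintro ⟨t, ht, hz⟩
          exact ⟨t'.2, t.1, ht, hz⟩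
      · exact fun b t' ht' => ht'.2
    · simp at hel
  · rintro (⟨a, s⟩ | V) (⟨a', s'⟩ | V') (⟨b, t⟩ | U) hW hel hm <;>
      simp only [W, acceptanceGame] at hW hel hm
    · simp at hel
    · obtain ⟨t₀, ht₀, hz⟩ := hW b t hm
      exact ⟨Sum.inl (b, t₀), ht₀, rfl, hz⟩
  · intro π π' hW hwin
    have : (fun i => Sum.elim (fun p : A × S.Node => 𝔸.prio p.1) (fun _ => 0) (π i)) =
        fun i => Sum.elim (fun p : A × S'.Node => 𝔹.prio p.1) (fun _ => 0) (π' i) := by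
      funext i
      have := hW i
      revert this
      generalize π i = p
      generalize π' i = q
      rcases p with (⟨a, s⟩ | V) <;> rcases q with (⟨a', s'⟩ | V') <;> simp +contextual [W, hprio]
    have h2 := fun i => congrFun this i
    simpa only [acceptanceGame, ParityWin, h2] using hwin

namespace Formula

variable {A : Type*}

/-! ### Semantics of one-step formulas -/

theorem sat_bigAnd {D : Type*} {V : A → Set D} {n : ℕ} {l : List (Formula A n)} {g : Fin n → D} :
    (bigAnd l).Sat V g ↔ ∀ φ ∈ l, φ.Sat V g := by
  induction l with
  | nil => simp [bigAnd, Sat]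
  | cons φ l ih =>
    change φ.Sat V g ∧ (bigAnd l).Sat V g ↔ _
    simp [ih]

theorem sat_bigOr {D : Type*} {V : A → Set D} {n : ℕ} {l : List (Formula A n)} {g : Fin n → D} :
    (bigOr l).Sat V g ↔ ∃ φ ∈ l, φ.Sat V g := by
  induction l with
  | nil => simp [bigOr, Sat]
  | cons φ l ih =>
    change φ.Sat V g ∨ (bigOr l).Sat V g ↔ _
    simp [ih]

theorem sat_typeFormula {D : Type*} {V : A → Set D} {n : ℕ} {T : Finset A} {x : Fin n}
    {g : Fin n → D} : (typeFormula T x).Sat V g ↔ ∀ a ∈ T, g x ∈ V a := by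
  simp [typeFormula, sat_bigAnd, Sat]

theorem sat_someType {D : Type*} {V : A → Set D} {n : ℕ} {Ss : List (Finset A)} {x : Fin n}
    {g : Fin n → D} : (someType Ss x).Sat V g ↔ ∃ S ∈ Ss, ∀ a ∈ S, g x ∈ V a := by
  simp [someType, sat_bigOr, sat_typeFormula]

theorem sat_dual {D : Type*} {V : A → Set D} {n : ℕ} (φ : Formula A n) (g : Fin n → D) :
    φ.dual.Sat V g ↔ ¬ φ.Sat (fun a => (V a)ᶜ) g := by
  induction φ with
  | and φ ψ h1 h2 => simp only [dual, Sat, h1, h2]; tauto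
  | or φ ψ h1 h2 => simp only [dual, Sat, h1, h2]; tauto
  | exInf φ ih => simp [dual, Sat, ih]
  | allInf φ ih => simp only [dual, Sat, ih]; exact Iff.rfl
  | _ => simp_all [dual, Sat]

theorem dual_dual {n : ℕ} (φ : Formula A n) : φ.dual.dual = φ := by
  induction φ <;> simp_all [dual]

theorem In.dual {L : Lang} {n : ℕ} {φ : Formula A n} (h : φ.In L) : φ.dual.In L := by
  induction φ <;> grind [Formula.dual, In]

theorem occurs_dual {n : ℕ} {φ : Formula A n} {a : A} : φ.dual.Occurs a ↔ φ.Occurs a := by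
  induction φ <;> simp_all [Formula.dual, Occurs]

theorem sat_diff {D : Type*} {V : A → Set D} {n : ℕ} {g : Fin n → D} :
    (diff n).Sat V g ↔ Function.Injective g := by
  simp only [diff, sat_bigAnd, List.mem_map, List.mem_filter, List.mem_product, List.mem_finRange,
    decide_eq_true_eq, forall_exists_index, and_imp, Prod.forall]
  constructor
  · intro h i j hij
    by_contra hne
    rcases lt_or_gt_of_ne hne with hlt | hlt
    · exact h _ i j trivial trivial hlt rfl hij
    · exact h _ j i trivial trivial hlt rfl hij.symm
  · rintro h _ i j - - hlt rfl hij
    exact hlt.ne (h hij)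

theorem holds_exs {D : Type*} {V : A → Set D} {n : ℕ} {φ : Formula A n} :
    (exs n φ).Holds V ↔ ∃ g : Fin n → D, φ.Sat V g := by
  induction n with
  | zero =>
    refine ⟨fun h => ⟨_, h⟩, fun ⟨g, h⟩ => ?_⟩
    rwa [Subsingleton.elim g Fin.elim0] at h
  | succ n ih =>
    rw [exs, ih]
    refine ⟨fun ⟨g, d, h⟩ => ⟨_, h⟩, fun ⟨g, h⟩ => ⟨Fin.init g, g (Fin.last n), ?_⟩⟩
    rwa [Fin.snoc_init_self]

theorem holds_nablaFOE {D : Type*} {V : A → Set D} {Ts Ps : List (Finset A)} :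
    (nablaFOE Ts Ps).Holds V ↔ ∃ g : Fin Ts.length → D, Function.Injective g ∧
      (∀ i, ∀ a ∈ Ts.get i, g i ∈ V a) ∧
      ∀ z, (∀ i, g i ≠ z) → ∃ S ∈ Ps, ∀ a ∈ S, z ∈ V a := by
  rw [nablaFOE, holds_exs]
  refine exists_congr fun g => (and_congr_left' sat_diff).trans <| and_congr_right fun hg =>
    and_congr ?_ (forall_congr' fun z => ?_)
  · simp [sat_bigAnd, sat_typeFormula]
  · change (diff _).dual.Sat _ _ ∨ (someType Ps _).Sat _ _ ↔ _
    rw [sat_dual, sat_diff, sat_someType, or_iff_not_imp_left, not_not]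
    have : Function.Injective (Fin.snoc g z : Fin (Ts.length + 1) → D) ↔ ∀ i, g i ≠ z := by
      rw [Fin.snoc_injective_iff]
      simp [hg]
    simp [this]

theorem snoc_elim0_zero {D : Type*} (d : D) : (Fin.snoc Fin.elim0 d : Fin 1 → D) 0 = d :=
  Fin.snoc_last (α := fun _ => D) d Fin.elim0

theorem holds_nablaInf {D : Type*} {V : A → Set D} {Ss : List (Finset A)} :
    (nablaInf Ss).Holds V ↔ (∀ S ∈ Ss, {d | ∀ a ∈ S, d ∈ V a}.Infinite) ∧
      {d | ¬ ∃ S ∈ Ss, ∀ a ∈ S, d ∈ V a}.Finite := by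
  refine and_congr ?_ ?_
  · simp [sat_bigAnd, Sat, sat_typeFormula, snoc_elim0_zero]
  · simp [Sat, sat_someType, snoc_elim0_zero]

theorem holds_nablaFOEI {D : Type*} {V : A → Set D} {Ts Ps Ss : List (Finset A)} :
    (nablaFOEI Ts Ps Ss).Holds V ↔ (nablaFOE Ts (Ps ++ Ss)).Holds V ∧ (nablaInf Ss).Holds V :=
  Iff.rfl

theorem holds_nablaFO {D : Type*} {V : A → Set D} {Ts Ss : List (Finset A)} :
    (nablaFO Ts Ss).Holds V ↔ (∀ T ∈ Ts, ∃ d, ∀ a ∈ T, d ∈ V a) ∧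
      ∀ d, ∃ S ∈ Ss, ∀ a ∈ S, d ∈ V a := by
  refine and_congr ?_ ?_
  · simp [sat_bigAnd, Sat, sat_typeFormula, snoc_elim0_zero]
  · simp [Sat, sat_someType, snoc_elim0_zero]

theorem holds_bigOr {D : Type*} {V : A → Set D} {l : List (Formula A 0)} :
    (bigOr l).Holds V ↔ ∃ φ ∈ l, φ.Holds V :=
  sat_bigOr

theorem occurs_bigAnd {n : ℕ} {l : List (Formula A n)} {a : A} :
    (bigAnd l).Occurs a ↔ ∃ φ ∈ l, φ.Occurs a := by
  induction l with
  | nil => simp [bigAnd, Occurs]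
  | cons φ l ih =>
    change φ.Occurs a ∨ (bigAnd l).Occurs a ↔ _
    simp [ih]

theorem occurs_bigOr {n : ℕ} {l : List (Formula A n)} {a : A} :
    (bigOr l).Occurs a ↔ ∃ φ ∈ l, φ.Occurs a := by
  induction l with
  | nil => simp [bigOr, Occurs]
  | cons φ l ih =>
    change φ.Occurs a ∨ (bigOr l).Occurs a ↔ _
    simp [ih]

theorem occurs_typeFormula {n : ℕ} {T : Finset A} {x : Fin n} {a : A} :
    (typeFormula T x).Occurs a ↔ a ∈ T := by
  simp [typeFormula, occurs_bigAnd, Occurs]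

theorem occurs_someType {n : ℕ} {Ss : List (Finset A)} {x : Fin n} {a : A} :
    (someType Ss x).Occurs a ↔ ∃ S ∈ Ss, a ∈ S := by
  simp [someType, occurs_bigOr, occurs_typeFormula]

theorem occurs_nablaFO {Ts Ss : List (Finset A)} {a : A} :
    (nablaFO Ts Ss).Occurs a ↔ (∃ T ∈ Ts, a ∈ T) ∨ ∃ S ∈ Ss, a ∈ S := by
  refine or_congr ?_ occurs_someType
  simp [occurs_bigAnd, Occurs, occurs_typeFormula]

/-- Truth is monotone in the predicates that occur in the formula. -/
theorem Sat.mono {D : Type*} {V V' : A → Set D} {n : ℕ} {φ : Formula A n} {g : Fin n → D}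
    (h : φ.Sat V g) (hV : ∀ a, φ.Occurs a → V a ⊆ V' a) : φ.Sat V' g := by
  induction φ with
  | pred a x => exact hV a rfl h
  | eq x y => exact h
  | neq x y => exact h
  | top => trivial
  | bot => exact h
  | and φ ψ h1 h2 =>
    exact ⟨h1 h.1 fun a ha => hV a (Or.inl ha), h2 h.2 fun a ha => hV a (Or.inr ha)⟩
  | or φ ψ h1 h2 =>
    exact h.imp (fun h => h1 h fun a ha => hV a (Or.inl ha))
      fun h => h2 h fun a ha => hV a (Or.inr ha)
  | ex φ ih => exact h.imp fun d hd => ih hd hV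
  | all φ ih => exact fun d => ih (h d) hV
  | exInf φ ih => exact Set.Infinite.mono (fun d hd => ih hd hV) h
  | allInf φ ih => exact Set.Finite.subset h fun d hd hd' => hd (ih hd' hV)

/-- Truth depends only on the predicates that occur in the formula. -/
theorem sat_congr {D : Type*} {V V' : A → Set D} {n : ℕ} {φ : Formula A n} {g : Fin n → D}
    (hV : ∀ a, φ.Occurs a → V a = V' a) : φ.Sat V g ↔ φ.Sat V' g :=
  ⟨fun h => h.mono fun a ha => (hV a ha).subset, fun h => h.mono fun a ha => (hV a ha).superset⟩

/-- Positive formulas without equality are preserved along relations that are total, surjective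
and respect the predicates. -/
theorem Sat.of_relation {D D' : Type*} {V : A → Set D} {V' : A → Set D'} (Z : D → D' → Prop)
    (hZ : ∀ d, ∃ d', Z d d') (hZ' : ∀ d', ∃ d, Z d d')
    (hV : ∀ a d d', Z d d' → d ∈ V a → d' ∈ V' a) {n : ℕ} {φ : Formula A n} (hφ : φ.In Lang.FO)
    {g : Fin n → D} {g' : Fin n → D'} (hg : ∀ i, Z (g i) (g' i)) (h : φ.Sat V g) :
    φ.Sat V' g' := by
  have hsnoc : ∀ {n : ℕ} {g : Fin n → D} {g' : Fin n → D'} {d d'}, (∀ i, Z (g i) (g' i)) →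
      Z d d' → ∀ i, Z ((Fin.snoc g d : Fin (n + 1) → D) i)
        ((Fin.snoc g' d' : Fin (n + 1) → D') i) := by
    intro n g g' d d' hg hd i
    induction i using Fin.lastCases <;> simp [hg, hd]
  induction φ with
  | pred a x => exact hV a _ _ (hg x) h
  | eq x y => exact absurd rfl hφ
  | neq x y => exact absurd rfl hφ
  | top => trivial
  | bot => exact h
  | and φ ψ h1 h2 => exact ⟨h1 hφ.1 hg h.1, h2 hφ.2 hg h.2⟩
  | or φ ψ h1 h2 => exact h.imp (h1 hφ.1 hg) (h2 hφ.2 hg)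
  | ex φ ih =>
    obtain ⟨d, hd⟩ := h
    obtain ⟨d', hdd⟩ := hZ d
    exact ⟨d', ih hφ (hsnoc hg hdd) hd⟩
  | all φ ih =>
    intro d'
    obtain ⟨d, hdd⟩ := hZ' d'
    exact ih hφ (hsnoc hg hdd) (h d)
  | exInf φ ih => exact absurd hφ.1 (by simp)
  | allInf φ ih => exact absurd hφ.1 (by simp)

/-! ### The translation and infinite-to-one maps -/

/-- A map with infinite fibres cannot be distinguished from the projection `D × ω → D`: the
translation of a sentence holds in `(D, V)` iff the sentence holds in the inverse image. -/
theorem BasicDiamond.holds_iff {L : Lang} {α β : Formula A 0} (h : BasicDiamond L α β)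
    {D E : Type*} (p : E → D) (hp : ∀ d, (p ⁻¹' {d}).Infinite) (V : A → Set D) :
    β.Holds V ↔ α.Holds (fun a => p ⁻¹' V a) := by
  -- The conditions imposed by a basic formula on its witnesses and on the other elements.
  have hFOE : ∀ Ts Ps : List (Finset A),
      (nablaFOE Ts Ps).Holds (fun a => p ⁻¹' V a) ↔ (nablaFO Ts Ps).Holds V := by
    intro Ts Ps
    rw [holds_nablaFOE, holds_nablaFO]
    constructor
    · rintro ⟨g, -, hT, hP⟩
      refine ⟨fun T hT' => ?_, fun d => ?_⟩
      · obtain ⟨i, rfl⟩ := List.mem_iff_get.1 hT'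
        exact ⟨p (g i), hT i⟩
      · -- some element above `d` is not among the witnesses
        obtain ⟨z, hz, hzg⟩ := (hp d).exists_notMem_finite (Set.finite_range g)
        obtain ⟨S, hS, hS'⟩ := hP z fun i hi => hzg ⟨i, hi⟩
        refine ⟨S, hS, fun a ha => ?_⟩
        have := hS' a ha
        rwa [Set.mem_preimage, show p z = d from hz] at this
    · rintro ⟨hT, hP⟩
      choose w hw using fun i => hT (Ts.get i) (List.get_mem _ _)
      -- the `i`-th witness is the `i`-th of infinitely many elements above `w i`
      let e := fun d => (hp d).natEmbedding
      have hpe : ∀ d n, p (e d n) = d := fun d n => (e d n).2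
      refine ⟨fun i => e (w i) i, fun i j hij => ?_, fun i a ha => ?_, fun z _ => hP (p z)⟩
      · have hij' : (e (w i) i : E) = e (w j) j := hij
        have hw' : w i = w j := by rw [← hpe (w i) i, hij', hpe]
        rw [hw'] at hij'
        exact Fin.ext ((e (w j)).injective (Subtype.ext hij'))
      · rw [Set.mem_preimage, hpe]
        exact hw i a ha
  cases h with
  | foe Ts Ps hP => exact (hFOE Ts Ps).symm
  | foei Ts Ps Ss hPS =>
    rw [holds_nablaFOEI, hFOE, holds_nablaInf]
    simp only [holds_nablaFO]
    constructor
    · rintro ⟨hT, hS⟩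
      refine ⟨⟨hT, fun d => ?_⟩, fun S hSs => ?_, ?_⟩
      · obtain ⟨S, h1, h2⟩ := hS d
        exact ⟨S, List.mem_append_right _ h1, h2⟩
      · obtain ⟨d, hd⟩ := hT S (hPS S (List.mem_append_right _ hSs))
        refine (hp d).mono fun z hz a ha => ?_
        rw [Set.mem_preimage, show p z = d from hz]
        exact hd a ha
      · convert Set.finite_empty
        exact Set.eq_empty_of_forall_notMem fun z hz => hz (hS (p z))
    · rintro ⟨⟨hT, -⟩, -, hfin⟩
      refine ⟨hT, fun d => ?_⟩
      obtain ⟨z, hz, hz'⟩ := (hp d).exists_notMem_finite hfin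
      simp only [Set.mem_ofPred_eq, not_not, Set.mem_preimage] at hz'
      rwa [show p z = d from hz] at hz'

theorem IsDiamond.holds_iff {L : Lang} {α β : Formula A 0} (h : IsDiamond.{u} L α β)
    {D E : Type u} (p : E → D) (hp : ∀ d, (p ⁻¹' {d}).Infinite) (V : A → Set D) :
    β.Holds V ↔ α.Holds (fun a => p ⁻¹' V a) := by
  obtain ⟨l, hl, hα, rfl⟩ := h
  rw [hα, holds_bigOr, holds_bigOr]
  simp only [List.mem_map, exists_exists_and_eq_and]
  exact exists_congr fun q => and_congr_right fun hq => (hl q hq).holds_iff p hp V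

end Formula

/-! ### The omega-unravelling and bisimulation invariance -/

namespace LTS

variable {P : Type*} {S : LTS.{u} P}

/-- The node of the transition system in which a path ends. -/
def endNode (w : S.omegaUnravel.Node) : S.Node :=
  (w.1.map Prod.fst).getLastD S.root

/-- The one-step extension of the path `w` by the copy of `t` with index `k`. -/
def extend (w : S.omegaUnravel.Node) (t : {t : S.Node // S.R (endNode w) t}) (k : ℕ) :
    S.omegaUnravel.Node :=
  ⟨w.1 ++ [(t.1, k)], by
    have hw := w.2
    have ht : S.R ((w.1.map Prod.fst).getLastD S.root) t.1 := t.2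
    rw [List.getLastD_eq_getLast?] at ht
    rw [List.map_append, ← List.cons_append, List.isChain_append]
    refine ⟨hw, by simp, ?_⟩
    intro x hx y hy
    rw [List.getLast?_cons, Option.mem_some_iff] at hx
    simp only [List.map_cons, List.map_nil, List.head?_cons, Option.mem_some_iff] at hy
    rw [← hx, ← hy]
    exact ht⟩

theorem omegaUnravel_R_extend (w : S.omegaUnravel.Node)
    (t : {t : S.Node // S.R (endNode w) t}) (k : ℕ) : S.omegaUnravel.R w (extend w t k) :=
  ⟨_, rfl⟩

theorem endNode_extend (w : S.omegaUnravel.Node) (t : {t : S.Node // S.R (endNode w) t})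
    (k : ℕ) : endNode (extend w t k) = t.1 := by
  simp [endNode, extend]

theorem R_endNode {w w' : S.omegaUnravel.Node} (h : S.omegaUnravel.R w w') :
    S.R (endNode w) (endNode w') := by
  obtain ⟨p, hp⟩ := h
  have hw' := w'.2
  rw [hp, List.map_append, ← List.cons_append, List.isChain_append] at hw'
  have := hw'.2.2 (endNode w)
    (by rw [List.getLast?_cons, endNode, List.getLastD_eq_getLast?]; rfl) p.1 (by simp)
  simpa [endNode, hp] using this

/-- The projection from the successors of a path to the successors of its end node. -/
def succProj (w : S.omegaUnravel.Node) (t : {t : S.omegaUnravel.Node // S.omegaUnravel.R w t}) :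
    {t : S.Node // S.R (endNode w) t} :=
  ⟨endNode t.1, R_endNode t.2⟩

theorem infinite_preimage_succProj (w : S.omegaUnravel.Node)
    (t : {t : S.Node // S.R (endNode w) t}) : (succProj w ⁻¹' {t}).Infinite := by
  refine Set.infinite_of_injective_forall_mem
    (f := fun k : ℕ => (⟨extend w t k, omegaUnravel_R_extend w t k⟩ :
      {t : S.omegaUnravel.Node // S.omegaUnravel.R w t})) ?_ ?_
  · intro k k' h
    have h' := congrArg Subtype.val (congrArg Subtype.val h)
    simpa [extend] using h'
  · exact fun k => Subtype.ext (endNode_extend w t k)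

theorem bisimilar_omegaUnravel (S : LTS.{u} P) : Bisimilar S S.omegaUnravel := by
  refine ⟨fun s w => endNode w = s, ?_, rfl⟩
  rintro s w rfl
  refine ⟨rfl, fun t ht => ?_, fun w' hw' => ⟨_, R_endNode hw', rfl⟩⟩
  exact ⟨extend w ⟨t, ht⟩ 0, omegaUnravel_R_extend _ _ _, endNode_extend _ _ _⟩

end LTS

namespace Automaton

variable {L : Lang} {A P : Type*}

theorem accepts_diamond_iff (𝔸 : Automaton L A P) (d : Formula A 0 → Formula A 0)
    (hd : Formula.IsDiamondTranslation.{u} L d) (S : LTS.{u} P) :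
    (𝔸.diamond d hd).Accepts S ↔ 𝔸.Accepts S.omegaUnravel := by
  have hstep : ∀ a (w : S.omegaUnravel.Node) (V : A → Set {t // S.R (LTS.endNode w) t}),
      (d (𝔸.delta a (S.color (LTS.endNode w)))).Holds V ↔
        (𝔸.delta a (S.color (LTS.endNode w))).Holds (fun b => LTS.succProj w ⁻¹' V b) :=
    fun a w V => (hd _ (𝔸.delta_in _ _)).holds_iff _ (LTS.infinite_preimage_succProj w) V
  constructor
  · refine Accepts.of_relation (𝔸 := 𝔸.diamond d hd) (𝔹 := 𝔸)
      (fun s w => LTS.endNode w = s) rfl rfl rfl ?_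
    rintro a s w rfl V hV
    refine ((hstep a w V).1 hV).mono fun b _ t ht => ?_
    exact ⟨_, ht, rfl⟩
  · refine Accepts.of_relation (𝔸 := 𝔸) (𝔹 := 𝔸.diamond d hd)
      (fun w s => LTS.endNode w = s) rfl rfl rfl ?_
    rintro a w s rfl V hV
    refine (hstep a w _).2 ?_
    refine Formula.Sat.mono (φ := 𝔸.delta a (S.color (LTS.endNode w))) hV fun b _ t ht => ?_
    exact ⟨t, ht, rfl⟩

/-- Automata over the language without equality are bisimulation invariant. -/
theorem bisimulationInvariant_of_FO (𝔸 : Automaton Lang.FO A P) :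
    BisimulationInvariant.{u} 𝔸 := by
  have main : ∀ S S' : LTS.{u} P, ∀ Z : S.Node → S'.Node → Prop, IsBisimulation S S' Z →
      Z S.root S'.root → 𝔸.Accepts S → 𝔸.Accepts S' := by
    intro S S' Z hZ hroot h
    refine h.of_relation Z rfl rfl hroot ?_
    intro a s s' hs V hV
    obtain ⟨hc, hf, hb⟩ := hZ s s' hs
    rw [← hc]
    refine Formula.Sat.of_relation (fun t t' => Z t.1 t'.1) ?_ ?_ ?_ (𝔸.delta_in _ _)
      (fun i => i.elim0) hV
    · rintro ⟨t, ht⟩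
      obtain ⟨t', ht', hz⟩ := hf t ht
      exact ⟨⟨t', ht'⟩, hz⟩
    · rintro ⟨t', ht'⟩
      obtain ⟨t, ht, hz⟩ := hb t' ht'
      exact ⟨⟨t, ht⟩, hz⟩
    · exact fun b t t' hz ht => ⟨t, ht, hz⟩
  rintro S S' ⟨Z, hZ, hroot⟩
  refine ⟨main S S' Z hZ hroot, main S' S (fun s' s => Z s s') ?_ hroot⟩
  intro s' s hs
  obtain ⟨hc, hf, hb⟩ := hZ s s' hs
  exact ⟨hc.symm, hb, hf⟩

theorem bisimulationInvariant_iff_equivalent_diamond (𝔸 : Automaton L A P)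
    (d : Formula A 0 → Formula A 0) (hd : Formula.IsDiamondTranslation.{u} L d) :
    BisimulationInvariant.{u} 𝔸 ↔ Equivalent.{u} 𝔸 (𝔸.diamond d hd) := by
  refine ⟨fun h S => ?_, fun h S S' hS => ?_⟩
  · rw [accepts_diamond_iff]
    exact h _ _ S.bisimilar_omegaUnravel
  · rw [h S, h S']
    exact bisimulationInvariant_of_FO _ _ _ hS

/-! ### Weakness and continuity -/

theorem SameCluster.mono {L L' : Lang} {𝔸 : Automaton L A P} {𝔹 : Automaton L' A P}
    (h : ∀ a c b, (𝔹.delta a c).Occurs b → (𝔸.delta a c).Occurs b) {a b : A}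
    (hab : 𝔹.SameCluster a b) : 𝔸.SameCluster a b := by
  have hact : ∀ {a b}, 𝔹.Active a b → 𝔸.Active a b := fun hab =>
    Relation.TransGen.mono (fun a b ⟨c, hc⟩ => ⟨c, h a c b hc⟩) _ _ hab
  exact Relation.EqvGen.eqvGen_mono (fun a b hab => ⟨hact hab.1, hact hab.2⟩) _ _ hab

theorem Weak.mono {L L' : Lang} {𝔸 : Automaton L A P} {𝔹 : Automaton L' A P}
    (h : ∀ a c b, (𝔹.delta a c).Occurs b → (𝔸.delta a c).Occurs b)
    (hprio : 𝔸.prio = 𝔹.prio) (hw : 𝔸.Weak) : 𝔹.Weak := by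
  intro a b hab
  rw [← hprio]
  exact hw a b (hab.mono h)

end Automaton

namespace Formula

variable {A : Type*}

theorem In.of_FO {L : Lang} {n : ℕ} {φ : Formula A n} (h : φ.In Lang.FO) : φ.In L := by
  induction φ <;> simp_all [In]

theorem Cont.isIn {L : Lang} {B : Set A} {n : ℕ} {φ : Formula A n} (h : φ.Cont L B) :
    φ.In L := by
  induction h with
  | pred b x hb => trivial
  | free ψ hψ _ => exact hψ
  | and φ ψ _ _ h1 h2 => exact ⟨h1, h2⟩
  | or φ ψ _ _ h1 h2 => exact ⟨h1, h2⟩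
  | ex φ _ ih => exact ih
  | weakAll φ ψ hL _ hψ _ ih => exact ⟨⟨ih, hψ⟩, hL, hψ⟩

theorem Cont.anti {L : Lang} {B B' : Set A} (hB : B' ⊆ B) {n : ℕ} {φ : Formula A n}
    (h : φ.Cont L B) : φ.Cont L B' := by
  induction h with
  | pred b x hb =>
    by_cases hb' : b ∈ B'
    · exact .pred b x hb'
    · exact .free _ trivial fun c hc (hbc : b = c) => hb' (hbc ▸ hc)
  | free ψ hψ h => exact .free _ hψ fun b hb => h b (hB hb)
  | and φ ψ _ _ h1 h2 => exact .and _ _ h1 h2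
  | or φ ψ _ _ h1 h2 => exact .or _ _ h1 h2
  | ex φ _ ih => exact .ex _ ih
  | weakAll φ ψ hL _ hψ h ih => exact .weakAll _ _ hL ih hψ fun b hb => h b (hB hb)

theorem Cont.bigAnd {L : Lang} {B : Set A} {n : ℕ} {l : List (Formula A n)}
    (h : ∀ φ ∈ l, φ.Cont L B) : (bigAnd l).Cont L B := by
  induction l with
  | nil => exact .free _ trivial fun b _ h => h
  | cons φ l ih => exact .and _ _ (h φ (by simp)) (ih fun ψ hψ => h ψ (by simp [hψ]))

theorem Cont.bigOr {L : Lang} {B : Set A} {n : ℕ} {l : List (Formula A n)}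
    (h : ∀ φ ∈ l, φ.Cont L B) : (bigOr l).Cont L B := by
  induction l with
  | nil => exact .free _ trivial fun b _ h => h
  | cons φ l ih => exact .or _ _ (h φ (by simp)) (ih fun ψ hψ => h ψ (by simp [hψ]))

theorem Cont.typeFormula {L : Lang} {B : Set A} {n : ℕ} (T : Finset A) (x : Fin n) :
    (typeFormula T x).Cont L B := by
  refine .bigAnd fun φ hφ => ?_
  obtain ⟨a, -, rfl⟩ := List.mem_map.1 hφ
  exact Cont.anti (Set.subset_univ B) (.pred a x trivial)

/-- Without equality, a basic formula is continuous in the predicates that do not occur in its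
universal part. -/
theorem Cont.nablaFO {L : Lang} {B : Set A} {Ts Ss : List (Finset A)}
    (h : ∀ S ∈ Ss, ∀ b ∈ B, b ∉ S) : (nablaFO Ts Ss).Cont L B := by
  refine .and _ _ (.bigAnd fun φ hφ => ?_) (.free _ (nablaFO_in Ts Ss).2.of_FO ?_)
  · obtain ⟨T, -, rfl⟩ := List.mem_map.1 hφ
    exact .ex _ (.typeFormula T _)
  · intro b hb hocc
    obtain ⟨S, hS, hbS⟩ := occurs_someType.1 hocc
    exact h S hS b hb hbS

/-- A formula that is continuous in `B` stays true when the predicates in `B` are restricted to a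
suitable finite set, and hence to every larger one. -/
theorem Cont.exists_finite {L : Lang} {B : Set A} {n : ℕ} {φ : Formula A n} (h : φ.Cont L B)
    {D : Type*} {V : A → Set D} {g : Fin n → D} (hφ : φ.Sat V g) :
    ∃ F : Set D, F.Finite ∧ ∀ F', F ⊆ F' → φ.Sat (fun a => {d | d ∈ V a ∧ (a ∈ B → d ∈ F')}) g := by
  induction h with
  | pred b x hb =>
    exact ⟨{g x}, Set.finite_singleton _, fun F' hF => ⟨hφ, fun _ => hF rfl⟩⟩
  | free ψ _ h =>
    refine ⟨∅, Set.finite_empty, fun F' _ => (sat_congr fun a ha => ?_).1 hφ⟩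
    ext d
    exact ⟨fun hd => ⟨hd, fun hB => absurd ha (h a hB)⟩, fun hd => hd.1⟩
  | and φ ψ _ _ h1 h2 =>
    obtain ⟨F₁, hF₁, H₁⟩ := h1 hφ.1
    obtain ⟨F₂, hF₂, H₂⟩ := h2 hφ.2
    exact ⟨F₁ ∪ F₂, hF₁.union hF₂, fun F' hF =>
      ⟨H₁ F' (Set.subset_union_left.trans hF), H₂ F' (Set.subset_union_right.trans hF)⟩⟩
  | or φ ψ _ _ h1 h2 =>
    rcases hφ with hφ | hφ
    · obtain ⟨F, hF, H⟩ := h1 hφ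
      exact ⟨F, hF, fun F' hF' => Or.inl (H F' hF')⟩
    · obtain ⟨F, hF, H⟩ := h2 hφ
      exact ⟨F, hF, fun F' hF' => Or.inr (H F' hF')⟩
  | ex φ _ ih =>
    obtain ⟨d, hd⟩ := hφ
    obtain ⟨F, hF, H⟩ := ih hd
    exact ⟨F, hF, fun F' hF' => ⟨d, H F' hF'⟩⟩
  | weakAll φ ψ _ _ hψ h ih =>
    obtain ⟨hall, hfin⟩ := hφ
    -- Only the finitely many elements refuting `ψ` need a finite set for `φ`.
    have hψ' : ∀ F' : Set D, ∀ d, ψ.Sat V (Fin.snoc g d) →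
        ψ.Sat (fun a => {d | d ∈ V a ∧ (a ∈ B → d ∈ F')}) (Fin.snoc g d) := by
      refine fun F' d => (sat_congr fun a ha => ?_).1
      ext d
      exact ⟨fun hd => ⟨hd, fun hB => absurd ha (h a hB)⟩, fun hd => hd.1⟩
    have hex : ∀ d, ∃ F : Set D, F.Finite ∧ (¬ ψ.Sat V (Fin.snoc g d) → ∀ F', F ⊆ F' →
        φ.Sat (fun a => {d | d ∈ V a ∧ (a ∈ B → d ∈ F')}) (Fin.snoc g d)) := by
      intro d
      rcases hall d with hd | hd
      · obtain ⟨F, hF, H⟩ := ih hd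
        exact ⟨F, hF, fun _ => H⟩
      · exact ⟨∅, Set.finite_empty, fun hn => absurd hd hn⟩
    choose F hF H using hex
    refine ⟨⋃ d ∈ {d | ¬ ψ.Sat V (Fin.snoc g d)}, F d,
      Set.Finite.biUnion hfin fun d _ => hF d, fun F' hF' => ⟨fun d => ?_, ?_⟩⟩
    · by_cases hd : ψ.Sat V (Fin.snoc g d)
      · exact Or.inr (hψ' F' d hd)
      · exact Or.inl (H d hd F' ((Set.subset_biUnion_of_mem (u := F)
          (show d ∈ {d | ¬ ψ.Sat V (Fin.snoc g d)} from hd)).trans hF'))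
    · exact Set.Finite.subset hfin fun d hd hd' => hd (hψ' F' d hd')

/-- The translation of a continuous sentence is equivalent to a continuous sentence. In a basic
form it suffices to keep, in the universal part of the translation, the types disjoint from `B`:
over `D × ω` the predicates in `B` may be restricted to a finite set, which no fibre of the
projection to `D` is contained in. -/
theorem IsDiamond.exists_cont {B : Set A} {α β : Formula A 0}
    (h : IsDiamond.{u} Lang.FOEI α β) (hα : α.Cont Lang.FOEI B) :
    ∃ γ : Formula A 0, γ.Cont Lang.FO B ∧ Equiv.{u} β γ ∧ ∀ a, γ.Occurs a → β.Occurs a := by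
  classical
  have hβ := fun (D : Type u) V => h.holds_iff (Prod.fst : D × ℕ → D)
    (fun d => by
      refine Set.infinite_of_injective_forall_mem (f := fun k : ℕ => (d, k)) ?_ fun k => rfl
      exact Prod.mk_right_injective d) V
  obtain ⟨l, hl, hαl, rfl⟩ := h
  have hex : ∀ p : Formula A 0 × Formula A 0, ∃ γ : Formula A 0, p ∈ l → γ.Cont Lang.FO B ∧
      (∀ a, γ.Occurs a → p.2.Occurs a) ∧
      (∀ (D : Type u) (V : A → Set D), γ.Holds V → p.2.Holds V) ∧
      ∀ (D : Type u) (V : A → Set D) (F : Set (D × ℕ)), F.Finite →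
        p.1.Holds (fun a => {e | e.1 ∈ V a ∧ (a ∈ B → e ∈ F)}) → γ.Holds V := by
    rintro ⟨p, q⟩
    by_cases hp : (p, q) ∈ l
    swap
    · exact ⟨bot, fun h => absurd h hp⟩
    have hb := hl _ hp
    cases hb with
    | foei Ts Ps Ss hPS =>
      refine ⟨nablaFO Ts (Ss.filter fun S => ∀ b ∈ B, b ∉ S), fun _ => ⟨?_, ?_, ?_, ?_⟩⟩
      · refine .nablaFO fun S hS => ?_
        simpa using (List.mem_filter.1 hS).2
      · exact fun a ha => occurs_nablaFO.2 ((occurs_nablaFO.1 ha).imp id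
          fun ⟨S, hS, ha⟩ => ⟨S, List.mem_of_mem_filter hS, ha⟩)
      · exact fun D V hV => holds_nablaFO.2 ((holds_nablaFO.1 hV).imp id fun hS d =>
          let ⟨S, hS, hd⟩ := hS d
          ⟨S, List.mem_of_mem_filter hS, hd⟩)
      · rintro D V F hF ⟨hFOE, hInf⟩
        obtain ⟨g, -, hT, -⟩ := holds_nablaFOE.1 hFOE
        have hfin := (holds_nablaInf.1 hInf).2
        refine holds_nablaFO.2 ⟨fun T hT' => ?_, fun d => ?_⟩
        · obtain ⟨i, rfl⟩ := List.mem_iff_get.1 hT'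
          exact ⟨(g i).1, fun a ha => (hT i a ha).1⟩
        · obtain ⟨e, he, he'⟩ := (Set.infinite_of_injective_forall_mem
            (f := fun k : ℕ => (d, k)) (Prod.mk_right_injective d)
            (s := Prod.fst ⁻¹' {d}) fun k => rfl).exists_notMem_finite (hF.union hfin)
          simp only [Set.mem_union, Set.mem_ofPred_eq, not_or, not_not] at he'
          obtain ⟨heF, S, hS, heS⟩ := he'
          refine ⟨S, List.mem_filter.2 ⟨hS, ?_⟩, fun a ha => ?_⟩
          · simpa using fun b hb hbS => heF ((heS b hbS).2 hb)
          · have := (heS a ha).1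
            rwa [show e.1 = d from he] at this
  choose γ hγ using hex
  refine ⟨bigOr (l.map γ), .bigOr ?_, fun D V => ⟨fun hV => ?_, fun hV => ?_⟩, fun a ha => ?_⟩
  · intro φ hφ
    obtain ⟨p, hp, rfl⟩ := List.mem_map.1 hφ
    exact (hγ p hp).1
  · obtain ⟨F, hF, H⟩ := hα.exists_finite ((hβ D V).1 hV)
    obtain ⟨φ, hφ, hφV⟩ := holds_bigOr.1 ((hαl _ _).1 (H F subset_rfl))
    obtain ⟨p, hp, rfl⟩ := List.mem_map.1 hφ
    exact holds_bigOr.2 ⟨_, List.mem_map_of_mem hp, (hγ p hp).2.2.2 D V F hF hφV⟩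
  · obtain ⟨φ, hφ, hφV⟩ := holds_bigOr.1 hV
    obtain ⟨p, hp, rfl⟩ := List.mem_map.1 hφ
    exact holds_bigOr.2 ⟨_, List.mem_map_of_mem hp, (hγ p hp).2.2.1 D V hφV⟩
  · obtain ⟨φ, hφ, hφa⟩ := occurs_bigOr.1 ha
    obtain ⟨p, hp, rfl⟩ := List.mem_map.1 hφ
    exact occurs_bigOr.2 ⟨_, List.mem_map_of_mem hp, (hγ p hp).2.1 a hφa⟩

/-- The translation commutes with duals up to equivalence, since taking inverse images commutes
with complements. -/
theorem IsDiamond.equiv_dual {L : Lang} {α β β' : Formula A 0} (h : IsDiamond.{u} L α β)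
    (h' : IsDiamond.{u} L α.dual β') : Equiv.{u} β β'.dual := by
  intro D V
  have hp : ∀ d : D, ((Prod.fst : D × ℕ → D) ⁻¹' {d}).Infinite := fun d =>
    Set.infinite_of_injective_forall_mem (f := fun k : ℕ => (d, k))
      (Prod.mk_right_injective d) fun k => rfl
  rw [h.holds_iff _ hp]
  refine Iff.trans ?_ (sat_dual _ _).symm
  refine Iff.trans ?_ (not_congr (h'.holds_iff _ hp _)).symm
  refine Iff.trans ?_ (not_congr (sat_dual _ _)).symm
  simp only [not_not, Set.preimage_compl, compl_compl]
  exact Iff.rfl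

end Formula

theorem Automaton.WeakContinuous.exists_diamond {A P : Type*} {𝔸 : Automaton Lang.FOEI A P}
    (h𝔸 : 𝔸.WeakContinuous) (d : Formula A 0 → Formula A 0)
    (hd : Formula.IsDiamondTranslation.{u} Lang.FOEI d)
    (hadd : Formula.AddsNoPredicate Lang.FOEI d) :
    ∃ 𝔹 : Automaton Lang.FO A P, 𝔹.WeakContinuous ∧
      Automaton.OneStepEquiv.{u} (𝔸.diamond d hd) 𝔹 := by
  obtain ⟨hw, hc⟩ := h𝔸
  have hex : ∀ a c, ∃ γ : Formula A 0, γ.In Lang.FO ∧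
      Formula.Equiv.{u} (d (𝔸.delta a c)) γ ∧
      (∀ b, γ.Occurs b → (𝔸.delta a c).Occurs b) ∧
      (Odd (𝔸.prio a) → γ.Cont Lang.FO {b | 𝔸.SameCluster a b}) ∧
      (Even (𝔸.prio a) → γ.dual.Cont Lang.FO {b | 𝔸.SameCluster a b}) := by
    intro a c
    have hα := 𝔸.delta_in a c
    rcases Nat.even_or_odd (𝔸.prio a) with he | ho
    · -- the dual of the transition formula is continuous, and `d` applies to it as well
      obtain ⟨γ, h1, h2, h3⟩ := (hd _ hα.dual).exists_cont ((hc a c).2 he)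
      refine ⟨γ.dual, h1.isIn.dual, ?_, ?_, fun ho => absurd ho (Nat.not_odd_iff_even.2 he), ?_⟩
      · refine fun D V => ((hd _ hα).equiv_dual (hd _ hα.dual) D V).trans ?_
        refine (Formula.sat_dual _ _).trans ?_
        exact (not_congr (h2 D _)).trans (Formula.sat_dual _ _).symm
      · intro b hb
        exact Formula.occurs_dual.1 (hadd _ hα.dual b (h3 b (Formula.occurs_dual.1 hb)))
      · rw [Formula.dual_dual]
        exact fun _ => h1
    · obtain ⟨γ, h1, h2, h3⟩ := (hd _ hα).exists_cont ((hc a c).1 ho)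
      exact ⟨γ, h1.isIn, h2, fun b hb => hadd _ hα b (h3 b hb), fun _ => h1,
        fun he => absurd ho (Nat.not_odd_iff_even.2 he)⟩
  choose γ hin heq hocc hodd heven using hex
  let 𝔹 : Automaton Lang.FO A P := ⟨γ, hin, 𝔸.prio, 𝔸.init⟩
  have hsub : ∀ a, {b | 𝔹.SameCluster a b} ⊆ {b | 𝔸.SameCluster a b} := fun a b hb =>
    SameCluster.mono hocc hb
  exact ⟨𝔹, ⟨hw.mono hocc rfl, fun a c => ⟨fun ho => (hodd a c ho).anti (hsub a),
    fun he => (heven a c he).anti (hsub a)⟩⟩, rfl, rfl, heq⟩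

namespace Formula

variable {A : Type*}

/-! ### Truth is determined by truncated numbers of elements of each type -/

/-- The valuation in which `d` satisfies exactly the predicates in `c d`. -/
def ofTypes {D : Type*} (c : D → Finset A) : A → Set D := fun a => {d | a ∈ c d}

/-- Quantifier depth. -/
def depth : {n : ℕ} → Formula A n → ℕ
  | _, pred _ _ => 0
  | _, eq _ _ => 0
  | _, neq _ _ => 0
  | _, top => 0
  | _, bot => 0
  | _, and φ ψ => max φ.depth ψ.depth
  | _, or φ ψ => max φ.depth ψ.depth
  | _, ex φ => φ.depth + 1
  | _, all φ => φ.depth + 1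
  | _, exInf φ => φ.depth + 1
  | _, allInf φ => φ.depth + 1

/-- Every type is realized in `c` and `c'` by equally many elements, where numbers from `N` on are
not told apart, except, if `L` has the infinity quantifiers, for the distinction between finite
and infinite. -/
def SameProfile (L : Lang) (N : ℕ) {D D' : Type*} (c : D → Finset A) (c' : D' → Finset A) :
    Prop :=
  ∀ T, (∀ m : ℕ, m ≤ N → ((m : ℕ∞) ≤ (c ⁻¹' {T}).encard ↔ (m : ℕ∞) ≤ (c' ⁻¹' {T}).encard)) ∧
    (L = Lang.FOEI → ((c ⁻¹' {T}).Infinite ↔ (c' ⁻¹' {T}).Infinite))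

theorem SameProfile.symm {L : Lang} {N : ℕ} {D D' : Type*} {c : D → Finset A}
    {c' : D' → Finset A} (h : SameProfile L N c c') : SameProfile L N c' c :=
  fun T => ⟨fun m hm => ((h T).1 m hm).symm, fun hL => ((h T).2 hL).symm⟩

/-- The assignments `g` and `g'` have the same equalities and the same types. -/
def PartialIso {D D' : Type*} (c : D → Finset A) (c' : D' → Finset A) {n : ℕ} (g : Fin n → D)
    (g' : Fin n → D') : Prop :=
  (∀ i j, g i = g j ↔ g' i = g' j) ∧ ∀ i, c (g i) = c' (g' i)

namespace PartialIso

variable {D D' : Type*} {c : D → Finset A} {c' : D' → Finset A} {n : ℕ} {g : Fin n → D}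
  {g' : Fin n → D'}

theorem symm (h : PartialIso c c' g g') : PartialIso c' c g' g :=
  ⟨fun i j => (h.1 i j).symm, fun i => (h.2 i).symm⟩

theorem snoc (h : PartialIso c c' g g') {d : D} {d' : D'} (hd : ∀ i, g i = d ↔ g' i = d')
    (hc : c d = c' d') :
    PartialIso c c' (Fin.snoc g d : Fin (n + 1) → D) (Fin.snoc g' d' : Fin (n + 1) → D') := by
  constructor
  · intro i j
    induction i using Fin.lastCases <;> induction j using Fin.lastCases <;>
      simp [h.1, hd, eq_comm (a := d), eq_comm (a := d')]
  · intro i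
    induction i using Fin.lastCases <;> simp [h.2, hc]

/-- The forth property. -/
theorem exists_snoc (h : PartialIso c c' g g') {L : Lang} {N : ℕ}
    (hp : SameProfile L N c c') (hn : n < N) (d : D) :
    ∃ d', PartialIso c c' (Fin.snoc g d : Fin (n + 1) → D) (Fin.snoc g' d' : Fin (n + 1) → D') := by
  by_cases hd : ∃ i, g i = d
  · obtain ⟨i, rfl⟩ := hd
    exact ⟨g' i, h.snoc (fun j => h.1 j i) (h.2 i)⟩
  · -- The assignment `g` uses an element of the type of `d` less than there are.
    let I : Set (Fin n) := {i | c (g i) = c d}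
    obtain ⟨J, hJI, hJ⟩ := Set.exists_subset_bijOn I g
    have hle : (g' '' I).encard ≤ (g '' I).encard := by
      have hsub : g' '' I ⊆ g' '' J := by
        rintro _ ⟨i, hi, rfl⟩
        obtain ⟨j, hj, hji⟩ := hJ.surjOn ⟨i, hi, rfl⟩
        exact ⟨j, hj, (h.1 j i).1 hji⟩
      calc (g' '' I).encard ≤ (g' '' J).encard := Set.encard_le_encard hsub
        _ ≤ J.encard := Set.encard_image_le _ _
        _ = (g '' J).encard := hJ.injOn.encard_image.symm
        _ = (g '' I).encard := by rw [hJ.image_eq]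
    have hdI : d ∉ g '' I := fun ⟨i, _, hi⟩ => hd ⟨i, hi⟩
    have hfin : (g '' I).Finite := (Set.toFinite I).image g
    obtain ⟨k, hk⟩ := hfin.exists_encard_eq_coe
    have hkn : k ≤ n := by
      have : (g '' I).encard ≤ n := (Set.encard_image_le _ _).trans
        ((Set.encard_le_card).trans (by simp))
      rw [hk] at this
      exact_mod_cast this
    have hk1 : ((k + 1 : ℕ) : ℕ∞) ≤ (c ⁻¹' {c d}).encard := by
      calc ((k + 1 : ℕ) : ℕ∞) = (insert d (g '' I)).encard := by
            rw [Set.encard_insert_of_notMem hdI, hk]; simp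
        _ ≤ _ := by
            refine Set.encard_le_encard (Set.insert_subset rfl ?_)
            rintro _ ⟨i, hi, rfl⟩
            exact hi
    have hk2 := ((hp (c d)).1 (k + 1) (by omega)).1 hk1
    obtain ⟨d', hd', hd'I⟩ : ∃ d' ∈ c' ⁻¹' {c d}, d' ∉ g' '' I := by
      by_contra! hcon
      have h3 := (hk2.trans (Set.encard_le_encard (show c' ⁻¹' {c d} ⊆ g' '' I from hcon))).trans
        hle
      rw [hk] at h3
      have : k + 1 ≤ k := by exact_mod_cast h3
      omega
    refine ⟨d', h.snoc (fun i => ⟨fun hi => absurd ⟨i, hi⟩ hd, fun hi => absurd ⟨i, ?_, hi⟩ hd'I⟩)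
      (show c' d' = c d from hd').symm⟩
    change c (g i) = c d
    rw [h.2, hi]
    exact hd'

/-- Infinite definable sets remain infinite: one of the finitely many types occurs infinitely often
in the set, outside the range of the assignment, and the matching elements of the other model are
interchangeable. -/
theorem infinite_of_infinite [Finite A] (h : PartialIso c c' g g') {N : ℕ}
    (hp : SameProfile Lang.FOEI N c c') {p : D → Prop} {p' : D' → Prop}
    (hpp : ∀ d d', PartialIso c c' (Fin.snoc g d : Fin (n + 1) → D)
      (Fin.snoc g' d' : Fin (n + 1) → D') → p d → p' d') (hinf : {d | p d}.Infinite) :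
    {d' | p' d'}.Infinite := by
  have hinf' : ({d | p d} \ Set.range g).Infinite := hinf.sdiff (Set.finite_range g)
  obtain ⟨T, hT⟩ : ∃ T, (({d | p d} \ Set.range g) ∩ c ⁻¹' {T}).Infinite := by
    by_contra! hcon
    refine hinf' ((Set.finite_iUnion hcon).subset fun d hd => ?_)
    exact Set.mem_iUnion.2 ⟨c d, hd, rfl⟩
  obtain ⟨d, ⟨hd, hdg⟩, hdT⟩ := hT.nonempty
  have hT' := ((hp T).2 rfl).1 (hT.mono Set.inter_subset_right)
  refine (hT'.sdiff (Set.finite_range g')).mono fun d' hd' => ?_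
  refine hpp d d' (h.snoc (fun i => ?_) ?_) hd
  · exact ⟨fun hi => absurd ⟨i, hi⟩ hdg, fun hi => absurd ⟨i, hi⟩ hd'.2⟩
  · rw [show c d = T from hdT, show c' d' = T from hd'.1]

end PartialIso

/-- The back-and-forth argument. -/
theorem SameProfile.sat_iff [Finite A] {L : Lang} {N : ℕ} {D D' : Type*} {c : D → Finset A}
    {c' : D' → Finset A} (hp : SameProfile L N c c') {n : ℕ} {φ : Formula A n} (hφ : φ.In L)
    (hN : n + φ.depth ≤ N) {g : Fin n → D} {g' : Fin n → D'} (h : PartialIso c c' g g') :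
    φ.Sat (ofTypes c) g ↔ φ.Sat (ofTypes c') g' := by
  induction φ with
  | pred a x =>
    change a ∈ c (g x) ↔ a ∈ c' (g' x)
    rw [h.2]
  | eq x y => exact h.1 x y
  | neq x y => exact not_congr (h.1 x y)
  | top => exact Iff.rfl
  | bot => exact Iff.rfl
  | and φ ψ h1 h2 =>
    simp only [depth] at hN
    exact and_congr (h1 hφ.1 (by omega) h) (h2 hφ.2 (by omega) h)
  | or φ ψ h1 h2 =>
    simp only [depth] at hN
    exact or_congr (h1 hφ.1 (by omega) h) (h2 hφ.2 (by omega) h)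
  | ex φ ih =>
    simp only [depth] at hN
    constructor
    · rintro ⟨d, hd⟩
      obtain ⟨d', hd'⟩ := h.exists_snoc hp (by omega) d
      exact ⟨d', (ih hφ (by omega) hd').1 hd⟩
    · rintro ⟨d', hd⟩
      obtain ⟨d, hd'⟩ := h.symm.exists_snoc hp.symm (by omega) d'
      exact ⟨d, (ih hφ (by omega) hd'.symm).2 hd⟩
  | all φ ih =>
    simp only [depth] at hN
    constructor
    · intro hall d'
      obtain ⟨d, hd'⟩ := h.symm.exists_snoc hp.symm (by omega) d'
      exact (ih hφ (by omega) hd'.symm).1 (hall d)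
    · intro hall d
      obtain ⟨d', hd'⟩ := h.exists_snoc hp (by omega) d
      exact (ih hφ (by omega) hd').2 (hall d')
  | exInf φ ih =>
    simp only [depth] at hN
    obtain ⟨rfl, hφ⟩ := hφ
    exact ⟨h.infinite_of_infinite hp fun d d' hd => (ih hφ (by omega) hd).1,
      h.symm.infinite_of_infinite hp.symm fun d' d hd => (ih hφ (by omega) hd.symm).2⟩
  | allInf φ ih =>
    simp only [depth] at hN
    obtain ⟨rfl, hφ⟩ := hφ
    refine not_iff_not.1 ⟨h.infinite_of_infinite hp fun d d' hd => ?_,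
      h.symm.infinite_of_infinite hp.symm fun d' d hd => ?_⟩
    · exact mt (ih hφ (by omega) hd).2
    · exact mt (ih hφ (by omega) hd.symm).1

/-! ### Basic forms -/

/-- Countably many infinite sets have a system of distinct representatives. -/
theorem exists_injective_forall_mem_of_infinite {ι D : Type*} [Countable ι] (E : ι → Set D)
    (hE : ∀ i, (E i).Infinite) : ∃ f : ι → D, Function.Injective f ∧ ∀ i, f i ∈ E i := by
  classical
  obtain ⟨e, he⟩ := Countable.exists_injective_nat ι
  choose t ht htcard using fun i => (hE i).exists_subset_card_eq (e i + 1)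
  obtain ⟨f, hf, hft⟩ := (Finset.all_card_le_biUnion_card_iff_exists_injective t).1 fun s => by
    rcases s.eq_empty_or_nonempty with rfl | hs
    · simp
    · obtain ⟨i, hi, hmax⟩ := s.exists_max_image e hs
      calc s.card = (s.image e).card := (Finset.card_image_of_injective s he).symm
        _ ≤ (Finset.range (e i + 1)).card := Finset.card_le_card fun k hk => by
            obtain ⟨j, hj, rfl⟩ := Finset.mem_image.1 hk
            exact Finset.mem_range.2 (Nat.lt_succ_of_le (hmax j hj))
        _ = (t i).card := by rw [htcard, Finset.card_range]
        _ ≤ (s.biUnion t).card := Finset.card_le_card (Finset.subset_biUnion_of_mem t hi)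
  exact ⟨f, hf, fun i => ht i (hft i)⟩

/-- A basic formula whose list of types is the list of the types of the elements of a finite
set `W`. -/
theorem holds_nablaFOE_map {D D' : Type*} (c : D → Finset A) (W : Finset D)
    {Ps : List (Finset A)} {V : A → Set D'} :
    (nablaFOE (W.toList.map c) Ps).Holds V ↔ ∃ h : W → D', Function.Injective h ∧
      (∀ w, ∀ a ∈ c w.1, h w ∈ V a) ∧ ∀ z, (∀ w, h w ≠ z) → ∃ S ∈ Ps, ∀ a ∈ S, z ∈ V a := by
  classical
  let e : Fin (W.toList.map c).length ≃ W :=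
    (finCongr (by simp)).trans ((W.nodup_toList.getEquiv).trans
      (Equiv.subtypeEquivRight fun x => Finset.mem_toList))
  have he : ∀ i, c (e i).1 = (W.toList.map c).get i := fun i => by simp [e]
  rw [holds_nablaFOE]
  constructor
  · rintro ⟨g, hg, hT, hP⟩
    refine ⟨g ∘ e.symm, hg.comp e.symm.injective, fun w a ha => hT _ a ?_, fun z hz => hP z ?_⟩
    · rwa [← he, e.apply_symm_apply]
    · intro i hi
      exact hz (e i) (by simpa using hi)
  · rintro ⟨h, hh, hT, hP⟩
    refine ⟨h ∘ e, hh.comp e.injective, fun i a ha => hT _ a ?_, fun z hz => hP z ?_⟩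
    · rwa [he]
    · intro w hw
      exact hz (e.symm w) (by simpa using hw)

/-- In a model of a basic formula one can pick, for each element, a type among those that it has,
in such a way that the witnesses get the prescribed types, the other elements get types permitted
by the universal parts, and the types that should occur infinitely often do. -/
theorem exists_types {ι D : Type*} {V : A → Set D} {t : ι → Finset A} {h : ι → D} [Finite ι]
    (hinj : Function.Injective h) (ht : ∀ w, ∀ a ∈ t w, h w ∈ V a) {Ps Ss : Set (Finset A)}
    (hSs : Ss.Finite)
    (hP : ∀ z, (∀ w, h w ≠ z) → ∃ S ∈ Ps ∪ Ss, ∀ a ∈ S, z ∈ V a)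
    (hinf : ∀ S ∈ Ss, {d | ∀ a ∈ S, d ∈ V a}.Infinite) :
    ∃ c : D → Finset A, (∀ w, c (h w) = t w) ∧ (∀ z, (∀ w, h w ≠ z) → c z ∈ Ps ∪ Ss) ∧
      (∀ z, (∀ w, h w ≠ z) → (∃ S ∈ Ss, ∀ a ∈ S, z ∈ V a) → c z ∈ Ss) ∧
      (∀ S ∈ Ss, (c ⁻¹' {S}).Infinite) ∧ ∀ z, ∀ a ∈ c z, z ∈ V a := by
  have := hSs.to_subtype
  obtain ⟨f, hf, hfE⟩ := exists_injective_forall_mem_of_infinite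
    (fun q : ℕ × Ss => {d | ∀ a ∈ q.2.1, d ∈ V a} \ Set.range h)
    (fun q => (hinf _ q.2.2).sdiff (Set.finite_range h))
  have hex : ∀ z, ∃ T : Finset A, (∀ w, h w = z → T = t w) ∧ (∀ q, f q = z → T = q.2.1) ∧
      ((∀ w, h w ≠ z) → T ∈ Ps ∪ Ss) ∧
      ((∀ w, h w ≠ z) → (∃ S ∈ Ss, ∀ a ∈ S, z ∈ V a) → T ∈ Ss) ∧ ∀ a ∈ T, z ∈ V a := by
    intro z
    by_cases hz : ∃ w, h w = z
    · obtain ⟨w, rfl⟩ := hz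
      refine ⟨t w, fun w' hw' => by rw [hinj hw'], fun q hq => absurd ⟨w, hq.symm⟩ (hfE q).2,
        fun hn => absurd rfl (hn w), fun hn => absurd rfl (hn w), ht w⟩
    · have hz' : ∀ w, h w ≠ z := fun w hw => hz ⟨w, hw⟩
      by_cases hq : ∃ q, f q = z
      · obtain ⟨q, rfl⟩ := hq
        exact ⟨q.2.1, fun w hw => absurd hw (hz' w), fun q' hq' => by rw [hf hq'],
          fun _ => Or.inr q.2.2, fun _ _ => q.2.2, (hfE q).1⟩
      · by_cases hS : ∃ S ∈ Ss, ∀ a ∈ S, z ∈ V a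
        · obtain ⟨S, hS, hSz⟩ := hS
          exact ⟨S, fun w hw => absurd hw (hz' w), fun q' hq' => absurd ⟨q', hq'⟩ hq,
            fun _ => Or.inr hS, fun _ _ => hS, hSz⟩
        · obtain ⟨S, hSP, hSz⟩ := hP z hz'
          exact ⟨S, fun w hw => absurd hw (hz' w), fun q' hq' => absurd ⟨q', hq'⟩ hq,
            fun _ => hSP, fun _ hn => absurd hn hS, hSz⟩
  choose c h1 h2 h3 h4 h5 using hex
  refine ⟨c, fun w => h1 _ w rfl, h3, h4, fun S hS => ?_, h5⟩
  refine Set.infinite_of_injective_forall_mem (f := fun k : ℕ => f (k, ⟨S, hS⟩)) ?_ ?_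
  · exact fun k k' hk => congrArg Prod.fst (hf hk)
  · exact fun k => h2 _ _ rfl

/-- `(Ts, Ps, Ss)` describes the model given by `c` up to the threshold `N`: the list `Ts` contains
every type as often as it is realized, but at most `N` times, `Ps` consists of the types realized
at least `N` times and `Ss` of the types realized infinitely often. -/
def IsProfile (N : ℕ) {D : Type*} (c : D → Finset A) (Ts : List (Finset A))
    (Ps Ss : Finset (Finset A)) : Prop :=
  (∃ W : Finset D, Ts = W.toList.map c ∧
    ∀ T, {w | w ∈ W ∧ c w = T}.encard = min (c ⁻¹' {T}).encard N) ∧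
  (∀ T, T ∈ Ps ↔ (N : ℕ∞) ≤ (c ⁻¹' {T}).encard) ∧ ∀ T, T ∈ Ss ↔ (c ⁻¹' {T}).Infinite

theorem exists_isProfile [Finite A] (N : ℕ) {D : Type*} (c : D → Finset A) :
    ∃ Ts Ps Ss, IsProfile N c Ts Ps Ss := by
  classical
  cases nonempty_fintype A
  have hex : ∀ T, ∃ F : Set D, F ⊆ c ⁻¹' {T} ∧ F.encard = min (c ⁻¹' {T}).encard N := fun T =>
    Set.exists_subset_encard_eq (min_le_left _ _)
  choose F hF hFN using hex
  have hfin : ∀ T, (F T).Finite := fun T => by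
    rw [← Set.encard_lt_top_iff, hFN]
    exact (min_le_right _ _).trans_lt (ENat.natCast_lt_top N)
  refine ⟨_, Finset.univ.filter fun T => (N : ℕ∞) ≤ (c ⁻¹' {T}).encard,
    Finset.univ.filter fun T => (c ⁻¹' {T}).Infinite,
    ⟨(Set.finite_iUnion hfin).toFinset, rfl, fun T => ?_⟩, by simp, by simp⟩
  rw [← hFN]
  congr 1
  ext d
  simp only [Set.Finite.mem_toFinset, Set.mem_iUnion, Set.mem_ofPred_eq]
  constructor
  · rintro ⟨⟨T', hT'⟩, rfl⟩
    have : c d = T' := hF T' hT'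
    rwa [this]
  · exact fun hd => ⟨⟨T, hd⟩, hF T hd⟩

namespace IsProfile

variable {N : ℕ} {D : Type*} {c : D → Finset A} {Ts : List (Finset A)}
  {Ps Ss : Finset (Finset A)}

theorem subset (h : IsProfile N c Ts Ps Ss) {S : Finset A} (hS : S ∈ Ss) : S ∈ Ps := by
  rw [h.2.1, ((h.2.2 S).1 hS).encard_eq]
  exact le_top

theorem mem_of_mem (h : IsProfile N c Ts Ps Ss) (hN : 0 < N) {S : Finset A} (hS : S ∈ Ps) :
    S ∈ Ts := by
  obtain ⟨⟨W, rfl, hW⟩, hPs, -⟩ := h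
  have h1 := hW S
  rw [min_eq_right ((hPs S).1 hS)] at h1
  obtain ⟨w, hw, rfl⟩ : {w | w ∈ W ∧ c w = S}.Nonempty := by
    rw [← Set.encard_pos, h1]
    exact_mod_cast hN
  exact List.mem_map_of_mem (Finset.mem_toList.2 hw)

theorem exists_of_mem (h : IsProfile N c Ts Ps Ss) {T : Finset A} (hT : T ∈ Ts) :
    ∃ d, c d = T := by
  obtain ⟨⟨W, rfl, hW⟩, -⟩ := h
  obtain ⟨w, -, hw⟩ := List.mem_map.1 hT
  exact ⟨w, hw⟩

theorem length_le [Fintype A] (h : IsProfile N c Ts Ps Ss) :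
    Ts.length ≤ N * (Finset.univ : Finset (Finset A)).card := by
  classical
  obtain ⟨⟨W, rfl, hW⟩, -⟩ := h
  rw [List.length_map, Finset.length_toList]
  refine (Finset.card_le_mul_card_image (f := c) W N fun T _ => ?_).trans
    (Nat.mul_le_mul_left N (Finset.card_le_card (Finset.subset_univ _)))
  have h1 : ({w | w ∈ W ∧ c w = T}.encard : ℕ∞) ≤ N := (hW T).trans_le (min_le_right _ _)
  have h2 : {w | w ∈ W ∧ c w = T} = ((W.filter fun w => c w = T : Finset D) : Set D) := by
    ext; simp
  rw [h2, Set.encard_coe_eq_coe_finsetCard] at h1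
  exact_mod_cast h1

/-- A model satisfies the basic formula without infinity quantifiers that describes it. -/
theorem holds_nablaFOE (h : IsProfile N c Ts Ps Ss) {V : A → Set D}
    (hV : ∀ d, ∀ a ∈ c d, d ∈ V a) : (nablaFOE Ts Ps.toList).Holds V := by
  obtain ⟨⟨W, rfl, hW⟩, hPs, -⟩ := h
  refine (holds_nablaFOE_map c W).2 ⟨Subtype.val, Subtype.val_injective, fun w => hV w.1, ?_⟩
  refine fun z hz => ⟨c z, Finset.mem_toList.2 ((hPs _).2 ?_), hV z⟩
  -- If the type of `z` were realized less than `N` times, all its realizations would be in `W`.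
  by_contra hlt
  have h1 := hW (c z)
  rw [min_eq_left (not_le.1 hlt).le] at h1
  have h2 : {w | w ∈ W ∧ c w = c z} = c ⁻¹' {c z} :=
    ((W.finite_toSet.subset fun w hw => hw.1 :
      {w | w ∈ W ∧ c w = c z}.Finite)).eq_of_subset_of_encard_le (fun w hw => hw.2) h1.ge
  have h3 : z ∈ {w | w ∈ W ∧ c w = c z} := by rw [h2]; rfl
  exact hz ⟨z, h3.1⟩ rfl

theorem holds_nablaInf [Finite A] (h : IsProfile N c Ts Ps Ss) {V : A → Set D}
    (hV : ∀ d, ∀ a ∈ c d, d ∈ V a) : (nablaInf Ss.toList).Holds V := by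
  refine Formula.holds_nablaInf.2 ⟨fun S hS => ?_, ?_⟩
  · refine ((h.2.2 S).1 (Finset.mem_toList.1 hS)).mono fun d hd a ha => hV d a ?_
    rwa [show c d = S from hd]
  · refine ((Set.toFinite {T | T ∉ Ss}).biUnion (t := fun T => c ⁻¹' {T}) fun T hT =>
      Set.not_infinite.1 fun hinf => hT ((h.2.2 T).2 hinf)).subset fun d hd => ?_
    refine Set.mem_biUnion (x := c d) (fun hc => hd ?_) rfl
    exact ⟨c d, Finset.mem_toList.2 hc, hV d⟩

/-- A model of the basic formula describing `c` has, up to shrinking its valuation, the same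
profile as `c`. -/
theorem exists_sameProfile (h : IsProfile N c Ts Ps Ss) {L : Lang} {D' : Type*} {V : A → Set D'}
    (hFOE : (nablaFOE Ts Ps.toList).Holds V)
    (hInf : L = Lang.FOEI → (nablaInf Ss.toList).Holds V) :
    ∃ c' : D' → Finset A, SameProfile L N c c' ∧ ∀ d, ∀ a ∈ c' d, d ∈ V a := by
  obtain ⟨⟨W, rfl, hW⟩, hPs, hSs⟩ := h
  obtain ⟨h, hinj, hT, hP⟩ := (holds_nablaFOE_map c W).1 hFOE
  have hsub : ∀ S ∈ Ss, (N : ℕ∞) ≤ (c ⁻¹' {S}).encard := fun S hS => by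
    rw [((hSs S).1 hS).encard_eq]; exact le_top
  obtain ⟨c', h1, h2, h3, h4, h5⟩ := exists_types hinj hT (Ps := ↑Ps)
    (Ss := {S | L = Lang.FOEI ∧ S ∈ Ss}) (Ss.finite_toSet.subset fun S hS => hS.2)
    (fun z hz => (hP z hz).imp fun S hS => ⟨Or.inl (Finset.mem_toList.1 hS.1), hS.2⟩)
    (fun S hS => (Formula.holds_nablaInf.1 (hInf hS.1)).1 S (Finset.mem_toList.2 hS.2))
  have himage : ∀ T, (h '' {w | c w.1 = T}).encard = min (c ⁻¹' {T}).encard N := by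
    intro T
    rw [hinj.encard_image, ← hW, ← Subtype.val_injective.encard_image]
    congr 1
    ext d
    simp [and_comm]
  refine ⟨c', fun T => ⟨fun m hm => ⟨fun hle => ?_, fun hle => ?_⟩, fun hL => ⟨fun hi => ?_, ?_⟩⟩,
    h5⟩
  · have hm' : (m : ℕ∞) ≤ N := by exact_mod_cast hm
    refine (le_min hle hm').trans ((himage T).symm.trans_le (Set.encard_le_encard ?_))
    rintro _ ⟨w, hw, rfl⟩
    exact (h1 w).trans hw
  · by_cases hN : (N : ℕ∞) ≤ (c ⁻¹' {T}).encard
    · exact le_trans (by exact_mod_cast hm) hN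
    · refine hle.trans ((Set.encard_le_encard (t := h '' {w | c w.1 = T}) ?_).trans
        ((himage T).trans_le (min_le_left _ _)))
      intro z hz
      by_cases hzw : ∃ w, h w = z
      · obtain ⟨w, rfl⟩ := hzw
        exact ⟨w, (h1 w).symm.trans hz, rfl⟩
      · have := h2 z fun w hw => hzw ⟨w, hw⟩
        rw [show c' z = T from hz] at this
        exact absurd (this.elim (fun hT => (hPs T).1 hT) fun hT => hsub T hT.2) hN
  · exact h4 T ⟨hL, (hSs T).2 hi⟩
  · intro hi
    by_contra hT
    refine hi ((((Set.finite_range h).union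
      (Formula.holds_nablaInf.1 (hInf hL)).2)).subset fun z hz => ?_)
    by_cases hzw : ∃ w, h w = z
    · exact Or.inl hzw
    · refine Or.inr fun ⟨S, hS, hSz⟩ => hT ((hSs T).1 ?_)
      have := h3 z (fun w hw => hzw ⟨w, hw⟩) ⟨S, ⟨hL, Finset.mem_toList.1 hS⟩, hSz⟩
      rw [show c' z = T from hz] at this
      exact this.2

end IsProfile

/-- Every positive sentence has a basic form without new predicates: the disjunction of the
basic formulas that describe its models up to a threshold exceeding the quantifier depth. -/
theorem exists_isDiamond [Finite A] {L : Lang} (hL : L = Lang.FOE ∨ L = Lang.FOEI)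
    {α : Formula A 0} (hα : α.In L) :
    ∃ β, IsDiamond.{u} L α β ∧ ∀ a, β.Occurs a → α.Occurs a := by
  classical
  cases nonempty_fintype A
  let N := α.depth + 1
  -- the type of an element, restricted to the predicates that occur in `α`
  let typeOf : ∀ {D : Type u}, (A → Set D) → D → Finset A := fun V d =>
    Finset.univ.filter fun a => α.Occurs a ∧ d ∈ V a
  have htype : ∀ {D : Type u} (V : A → Set D) d, ∀ a ∈ typeOf V d, d ∈ V a := by
    intro D V d a ha
    exact (Finset.mem_filter.1 ha).2.2
  have hofTypes : ∀ {D : Type u} (V : A → Set D), α.Holds V ↔ α.Holds (ofTypes (typeOf V)) := by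
    intro D V
    refine sat_congr fun a ha => ?_
    ext d
    simp [ofTypes, typeOf, ha]
  let profiles : Set (List (Finset A) × Finset (Finset A) × Finset (Finset A)) :=
    {q | ∃ (D : Type u) (V : A → Set D), α.Holds V ∧ IsProfile N (typeOf V) q.1 q.2.1 q.2.2}
  have hfin : profiles.Finite := by
    refine ((List.finite_length_le (Finset A) (N * (Finset.univ : Finset (Finset A)).card)).prod
      (Set.finite_univ (α := Finset (Finset A) × Finset (Finset A)))).subset ?_
    rintro ⟨Ts, Ps, Ss⟩ ⟨D, V, -, h⟩
    exact ⟨h.length_le, trivial⟩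
  let pair : List (Finset A) × Finset (Finset A) × Finset (Finset A) →
      Formula A 0 × Formula A 0 := fun q =>
    if L = Lang.FOE then (nablaFOE q.1 q.2.1.toList, nablaFO q.1 q.2.1.toList)
    else (nablaFOEI q.1 q.2.1.toList q.2.2.toList, nablaFO q.1 q.2.2.toList)
  have hpair : ∀ q ∈ profiles, BasicDiamond L (pair q).1 (pair q).2 ∧
      (∀ a, (pair q).2.Occurs a → α.Occurs a) := by
    rintro ⟨Ts, Ps, Ss⟩ ⟨D, V, -, h⟩
    have hPT : ∀ S ∈ Ps, S ∈ Ts := fun S hS => h.mem_of_mem (Nat.succ_pos _) hS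
    have hocc : ∀ T ∈ Ts, ∀ a ∈ T, α.Occurs a := by
      intro T hT a ha
      obtain ⟨d, rfl⟩ := h.exists_of_mem hT
      exact (Finset.mem_filter.1 ha).2.1
    have hoccFO : ∀ Qs : List (Finset A), (∀ S ∈ Qs, S ∈ Ts) →
        ∀ a, (nablaFO Ts Qs).Occurs a → α.Occurs a := by
      intro Qs hQs a ha
      rcases occurs_nablaFO.1 ha with ⟨T, hT, haT⟩ | ⟨S, hS, haS⟩
      · exact hocc T hT a haT
      · exact hocc S (hQs S hS) a haS
    rcases hL with rfl | rfl
    · have hQ : ∀ S ∈ Ps.toList, S ∈ Ts := fun S hS => hPT S (Finset.mem_toList.1 hS)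
      simp only [pair, if_true]
      exact ⟨.foe _ _ hQ, hoccFO _ hQ⟩
    · simp only [pair, reduceCtorEq, if_false]
      refine ⟨.foei _ _ _ fun S hS => ?_, hoccFO _ fun S hS =>
        hPT S (h.subset (Finset.mem_toList.1 hS))⟩
      rcases List.mem_append.1 hS with hS | hS
      · exact hPT S (Finset.mem_toList.1 hS)
      · exact hPT S (h.subset (Finset.mem_toList.1 hS))
  have hsat : ∀ q ∈ profiles, ∀ {D : Type u} (V : A → Set D), (pair q).1.Holds V ↔
      (nablaFOE q.1 q.2.1.toList).Holds V ∧ (L = Lang.FOEI → (nablaInf q.2.2.toList).Holds V) := by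
    rintro ⟨Ts, Ps, Ss⟩ ⟨_, _, _, h⟩ D V
    rcases hL with rfl | rfl
    · simp [pair]
    · simp only [pair, reduceCtorEq, if_false, holds_nablaFOEI, forall_true_left]
      refine and_congr_left fun _ => ?_
      simp only [Formula.holds_nablaFOE, List.mem_append, Finset.mem_toList]
      have : ∀ S, S ∈ Ps ∨ S ∈ Ss ↔ S ∈ Ps := fun S => or_iff_left_of_imp h.subset
      simp only [this]
  refine ⟨_, ⟨hfin.toFinset.toList.map pair, ?_, fun D V => ⟨fun hV => ?_, fun hV => ?_⟩, rfl⟩,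
    fun a ha => ?_⟩
  · intro p hp
    obtain ⟨q, hq, rfl⟩ := List.mem_map.1 hp
    exact (hpair q (by simpa using hq)).1
  · obtain ⟨Ts, Ps, Ss, h⟩ := exists_isProfile N (typeOf V)
    have hq : (Ts, Ps, Ss) ∈ profiles := ⟨D, V, hV, h⟩
    refine holds_bigOr.2 ⟨(pair (Ts, Ps, Ss)).1, ?_, (hsat _ hq V).2
      ⟨h.holds_nablaFOE (htype V), fun _ => h.holds_nablaInf (htype V)⟩⟩
    exact List.mem_map_of_mem (List.mem_map_of_mem (by simpa using hq))
  · obtain ⟨φ, hφ, hφV⟩ := holds_bigOr.1 hV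
    obtain ⟨p, hp, rfl⟩ := List.mem_map.1 hφ
    obtain ⟨q, hq, rfl⟩ := List.mem_map.1 hp
    have hq : q ∈ profiles := by simpa using hq
    obtain ⟨D₀, V₀, hV₀, h⟩ := id hq
    obtain ⟨hFOE, hInf⟩ := (hsat q hq V).1 hφV
    obtain ⟨c', hc', hc'V⟩ := h.exists_sameProfile hFOE hInf
    have h1 : α.Holds (ofTypes c') :=
      (hc'.sat_iff hα (by omega) ⟨fun i => i.elim0, fun i => i.elim0⟩).1 ((hofTypes V₀).1 hV₀)
    exact h1.mono fun a _ d hd => hc'V d a hd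
  · obtain ⟨φ, hφ, hφa⟩ := occurs_bigOr.1 ha
    obtain ⟨p, hp, rfl⟩ := List.mem_map.1 hφ
    obtain ⟨q, hq, rfl⟩ := List.mem_map.1 hp
    exact (hpair q (by simpa using hq)).2 a hφa

end Formula

end OneStepAut

theorem mainTheorem10 (L : Lang) (hL : L = Lang.FOE ∨ L = Lang.FOEI)
    (A : Type*) [Finite A] (P : Type*) :
    (∃ d : Formula A 0 → Formula A 0,
      Formula.IsDiamondTranslation.{u} L d ∧ Formula.AddsNoPredicate L d) ∧
    (∀ (d : Formula A 0 → Formula A 0) (hd : Formula.IsDiamondTranslation.{u} L d)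
      (𝔸 : Automaton L A P),
      (∀ S : LTS.{u} P, (𝔸.diamond d hd).Accepts S ↔ 𝔸.Accepts S.omegaUnravel) ∧
      (Automaton.BisimulationInvariant.{u} 𝔸 ↔
        Automaton.Equivalent.{u} 𝔸 (𝔸.diamond d hd)) ∧
      (Formula.AddsNoPredicate L d →
        (𝔸.Weak → (𝔸.diamond d hd).Weak) ∧
        (L = Lang.FOEI → 𝔸.WeakContinuous →
          ∃ 𝔹 : Automaton Lang.FO A P,
            𝔹.WeakContinuous ∧ Automaton.OneStepEquiv.{u} (𝔸.diamond d hd) 𝔹))) := by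
  refine ⟨?_, fun d hd 𝔸 => ⟨𝔸.accepts_diamond_iff d hd,
    𝔸.bisimulationInvariant_iff_equivalent_diamond d hd, fun hadd => ⟨?_, ?_⟩⟩⟩
  · have hex : ∀ α : Formula A 0, ∃ β, α.In L →
        Formula.IsDiamond.{u} L α β ∧ ∀ a, β.Occurs a → α.Occurs a := by
      intro α
      by_cases hα : α.In L
      · obtain ⟨β, hβ⟩ := Formula.exists_isDiamond hL hα
        exact ⟨β, fun _ => hβ⟩
      · exact ⟨α, fun h => absurd h hα⟩
    choose d hd using hex
    exact ⟨d, fun α hα => (hd α hα).1, fun α hα => (hd α hα).2⟩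
  · exact fun hw => hw.mono (fun a c => hadd _ (𝔸.delta_in a c)) rfl
  · rintro rfl hw
    exact hw.exists_diamond d hd hadd
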